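/- Let $\delta>0$, $q<1$, $V\ge 0$ and $\Lambda>0$. There is a constant $C>0$, depending only on $\delta,q,V,\Lambda$, such that the following holds for all $c_0,\omega_0,T>0$ with $V\le q\,c_0$ and $\min\{T,1/\omega_0\}\le\Lambda$. Let $z_0\in C^1([0,T];\mathbb R^3)$ be the path of a point source with speed $\|z_0'(t)\|\le V$ on $(0,T)$ (hence strictly less than $c_0$), and let $\Gamma\subset\mathbb R^3$ satisfy $\|x-z_0(t)\|\ge\delta$ for all $x\in\Gamma$, $t\in[0,T]$. Let $u_0$ be the solution of $$\frac1{c_0^2}\,\partial_t^2u_0-\Delta u_0=\mathbf 1_{(0,T)}(t)\,\sin(\omega_0t)\,\delta(x-z_0(t))\ \text{ in }\mathbb R^3\times(0,\infty),\qquad u_0(\cdot,0)=\partial_tu_0(\cdot,0)=0,$$ in the weak sense: $u_0$ is locally integrable on $\mathbb R^3\times[0,\infty)$, it is continuous on $\{(x,t):0<t<T,\ x\ne z_0(t)\}$, and for every $\varphi\in C_c^\infty(\mathbb R^3\times\mathbb R)$ $$\int_0^\infty\!\!\int_{\mathbb R^3}u_0\,\bigl(c_0^{-2}\partial_t^2\varphi-\Delta\varphi\bigr)\,dx\,dt=\int_0^T\sin(\omega_0t)\,\varphi(z_0(t),t)\,dt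 .$$ For $x\in\Gamma$ and $t\in(0,T)$ let $\tau=\tau(x,t)$ be the retarded time, i.e. the solution of $\tau=t-\|x-z_0(\tau)\|/c_0$, where $z_0(s):=z_0(0)$ for $s<0$. Let $\varepsilon:(0,T)\to\mathbb R$ be a function with $$t-\tau(x,t)=\frac{\|x-z_0(\tau(x,t))\|}{c_0}\le\varepsilon(t)\,\frac{2\pi}{\omega_0}\qquad\text{for all }(x,t)\in\Gamma\times(0,T)$$ (in particular, equality is allowed; the case of interest is $0<\varepsilon(t)\ll1$). Then $$\left|u_0(x,t)-\frac{\sin(\omega_0t)}{4\pi\|x-z_0(t)\|}\right|\le C\,\varepsilon(t)\qquad\text{for all }(x,t)\in\Gamma\times(0,T).$$ -/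

import Mathlib

open MeasureTheory Set
open scoped ContDiff

/-- Euclidean three-dimensional space. -/
abbrev R3 : Type := EuclideanSpace ℝ (Fin 3)

/-- The d'Alembert operator `c₀⁻² ∂ₜ² φ - Δₓ φ` applied to a function of `(x, t)`. -/
noncomputable def waveOp (c₀ : ℝ) (φ : R3 × ℝ → ℝ) (p : R3 × ℝ) : ℝ :=
  (1 / c₀ ^ 2) * iteratedDeriv 2 (fun s : ℝ => φ (p.1, s)) p.2
    - Laplacian.laplacian (fun y : R3 => φ (y, p.2)) p.1

/-- `u` is the wave field in a homogeneous medium of speed `c₀` that is radiated by the moving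
point source `sin (ω₀ t) δ(x - z t)`, which emits during the time interval `(0, T)`:
`c₀⁻² ∂ₜ² u - Δ u = 1_{(0,T)}(t) sin (ω₀ t) δ(x - z t)` for `t > 0`, and `u = ∂ₜ u = 0` at `t = 0`.

The equation and the zero initial conditions are understood in the usual weak sense: both
derivatives are moved to the test functions, and the test functions are smooth with compact
support in the whole space-time and need not vanish at `t = 0`, so that no boundary term at
`t = 0` being present expresses the initial conditions. Since a locally integrable function is
determined only almost everywhere, `u` is required to be the representative that is continuous
off the source for `0 < t < T`, so that it has values at single points there. -/
structure IsMovingSourceField (c₀ ω₀ T : ℝ) (z : ℝ → R3) (u : R3 → ℝ → ℝ) : Prop where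
  /-- local integrability up to the initial time -/
  locallyIntegrable :
    LocallyIntegrableOn (fun p : R3 × ℝ => u p.1 p.2) {p : R3 × ℝ | 0 ≤ p.2}
  /-- continuity in `(x, t)` off the trajectory -/
  continuousOn :
    ContinuousOn (fun p : R3 × ℝ => u p.1 p.2) {p : R3 × ℝ | 0 < p.2 ∧ p.2 < T ∧ p.1 ≠ z p.2}
  /-- the wave equation with zero initial data, tested with `φ` -/
  weak_eq : ∀ φ : R3 × ℝ → ℝ, ContDiff ℝ ∞ φ → HasCompactSupport φ →
    ∫ p in {p : R3 × ℝ | 0 < p.2}, u p.1 p.2 * waveOp c₀ φ p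
      = ∫ t in (0 : ℝ)..T, Real.sin (ω₀ * t) * φ (z t, t)

/-- `s` is the retarded time of `(x, t)`, that is `s = t - ‖x - z s‖ / c₀`. The source is taken to
rest at `z 0` before the time `0`, so that points which the signal has not reached yet
have a retarded time as well, a nonpositive one. -/
def IsRetardedTime (c₀ : ℝ) (z : ℝ → R3) (x : R3) (t s : ℝ) : Prop :=
  s = t - ‖x - z (max s 0)‖ / c₀

/-! The field is identified explicitly, and the explicit formula is then compared with the
quasi-static one.

Identification is by duality. For `ψ` smooth and supported in `0 < t < T` off the trajectory, the
advanced potential `A` of `ψ`, the integral of `ψ` over future light cones with weight `1 /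
(4π‖h‖)`, solves the wave equation with right-hand side `ψ` (`waveOp_advancedPotential_eq`). Cut off
in the past, `A` becomes an admissible test function, so `∫ u ψ` equals the integral of `sin (ω₀ t)
A(z t, t)` over `(0, T)`. For a fixed receiver `y`, the substitution `s = t + ‖y - z t‖ / c` from
emission to arrival time turns this into `∫ L ψ`, where `L` is the Liénard–Wiechert field `sin (ω₀
τ) / (4π (r - r·v/c))`, with `r·v` the inner product of the separation vector and the velocity at
time `τ`. Hence `u = L` almost everywhere off the source, and everywhere there by continuity
(`IsMovingSourceField.eq_lienardWiechert`).

The comparison (`abs_lienardWiechert_sub_le`) rests on two bounds. Replacing `τ` by `t` in the sine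
costs at most `ω₀ (t - τ) ≤ 2π ε`. The denominators differ by at most `2 V (t - τ)`, of order `ε /
ω₀`; the stray `1 / ω₀` is absorbed by the factor `|sin (ω₀ t)|`, since `|sin (ω₀ t)| / ω₀ ≤ min T
(1 / ω₀) ≤ Λ`. -/

open Filter Topology

/-! ### Directional derivatives in space-time and the wave operator. -/

/-- The derivative of `f` in the direction `v`. -/
noncomputable def dirDeriv {E : Type*} [NormedAddCommGroup E] [NormedSpace ℝ E] (v : E)
    (f : E → ℝ) (p : E) : ℝ :=
  fderiv ℝ f p v

section dirDeriv

variable {E : Type*} [NormedAddCommGroup E] [NormedSpace ℝ E] {f g : E → ℝ}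

theorem ContDiff.dirDeriv (hf : ContDiff ℝ ∞ f) (v : E) : ContDiff ℝ ∞ (dirDeriv v f) :=
  (hf.fderiv_right (m := ∞) (by simp)).clm_apply contDiff_const

theorem HasCompactSupport.dirDeriv (hf : HasCompactSupport f) (v : E) :
    HasCompactSupport (dirDeriv v f) :=
  hf.fderiv_apply ℝ v

theorem dirDeriv_congr_of_eventuallyEq {p : E} (h : f =ᶠ[nhds p] g) (v : E) :
    dirDeriv v f =ᶠ[nhds p] dirDeriv v g := by
  filter_upwards [h.fderiv (𝕜 := ℝ)] with q hq
  simp [dirDeriv, hq]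

theorem dirDeriv_comm (hf : ContDiff ℝ ∞ f) (v w : E) (p : E) :
    dirDeriv v (dirDeriv w f) p = dirDeriv w (dirDeriv v f) p := by
  have hd : DifferentiableAt ℝ (fderiv ℝ f) p :=
    ((hf.fderiv_right (m := ∞) (by simp)).differentiable (by simp)) p
  have hs := (hf.contDiffAt (x := p)).isSymmSndFDerivAt (by simpa using ENat.LEInfty.out)
  have key : ∀ a b : E, dirDeriv a (dirDeriv b f) p = fderiv ℝ (fderiv ℝ f) p a b := by
    intro a b
    change fderiv ℝ (fun q => fderiv ℝ f q b) p a = _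
    rw [fderiv_clm_apply hd (differentiableAt_const b)]
    simp
  rw [key, key, hs.eq]

theorem dirDeriv_comp_add_left (f : E → ℝ) (v a p : E) :
    dirDeriv v (fun q => f (a + q)) p = dirDeriv v f (a + p) := by
  simp [dirDeriv, fderiv_comp_add_left]

end dirDeriv

/-- The coordinate directions of space, in space-time. -/
noncomputable abbrev spaceDir (i : Fin 3) : R3 × ℝ := (EuclideanSpace.single i 1, 0)

/-- The time direction in space-time. -/
abbrev timeDir : R3 × ℝ := (0, 1)

/-- In this form the operator is built from derivatives on one space, which commute with
translations and can be moved under the cone integrals. -/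
theorem waveOp_eq_dirDeriv {f : R3 × ℝ → ℝ} (hf : ContDiff ℝ ∞ f) (c : ℝ) (p : R3 × ℝ) :
    waveOp c f p = (1 / c ^ 2) * dirDeriv timeDir (dirDeriv timeDir f) p
      - ∑ i, dirDeriv (spaceDir i) (dirDeriv (spaceDir i) f) p := by
  have hfd : Differentiable ℝ f := hf.differentiable (by simp)
  unfold waveOp
  congr 2
  · have h1 : ∀ g : R3 × ℝ → ℝ, Differentiable ℝ g →
        deriv (fun s => g (p.1, s)) = fun s => dirDeriv timeDir g (p.1, s) := by
      intro g hg
      ext s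
      have := (hg (p.1, s)).hasFDerivAt.comp_hasDerivAt s
        ((hasDerivAt_const s p.1).prodMk (hasDerivAt_id s))
      exact this.deriv
    rw [iteratedDeriv_succ, iteratedDeriv_one, h1 f hfd,
      h1 _ ((hf.dirDeriv timeDir).differentiable (by simp))]
  · rw [InnerProductSpace.laplacian_eq_iteratedFDeriv_orthonormalBasis _
      (EuclideanSpace.basisFun (Fin 3) ℝ)]
    refine Finset.sum_congr rfl fun i _ => ?_
    have h1 : ∀ g : R3 × ℝ → ℝ, Differentiable ℝ g → ∀ v y,
        fderiv ℝ (fun x => g (x, p.2)) y v = dirDeriv (v, 0) g (y, p.2) := by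
      intro g hg v y
      have h2 : HasFDerivAt (fun x : R3 => (x, p.2))
          ((ContinuousLinearMap.id ℝ R3).prod 0) y :=
        (hasFDerivAt_id y).prodMk (hasFDerivAt_const p.2 y)
      have := (hg (y, p.2)).hasFDerivAt.comp y h2
      change fderiv ℝ (g ∘ fun x => (x, p.2)) y v = _
      rw [this.fderiv]
      simp [dirDeriv]
    have hg : ContDiff ℝ ∞ (fun y : R3 => f (y, p.2)) := hf.comp (by fun_prop)
    rw [iteratedFDeriv_two_apply]
    have hd : DifferentiableAt ℝ (fderiv ℝ (fun y : R3 => f (y, p.2))) p.1 :=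
      ((hg.fderiv_right (m := ∞) (by simp)).differentiable (by simp)) p.1
    have h2 := fderiv_clm_apply hd
      (differentiableAt_const (EuclideanSpace.single i (1 : ℝ) : R3))
    have h3 := congrArg (fun A : R3 →L[ℝ] ℝ => A (EuclideanSpace.single i 1)) h2
    simp only [h1 f hfd] at h3
    rw [h1 (dirDeriv (EuclideanSpace.single i 1, 0) f)
      ((hf.dirDeriv _).differentiable (by simp))] at h3
    simpa using h3.symm

theorem waveOp_congr_of_eventuallyEq {f g : R3 × ℝ → ℝ} (hf : ContDiff ℝ ∞ f)
    (hg : ContDiff ℝ ∞ g) (c : ℝ) {p : R3 × ℝ} (h : f =ᶠ[nhds p] g) :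
    waveOp c f p = waveOp c g p := by
  have h2 : ∀ v, dirDeriv v (dirDeriv v f) p = dirDeriv v (dirDeriv v g) p := fun v =>
    (dirDeriv_congr_of_eventuallyEq (dirDeriv_congr_of_eventuallyEq h v) v).eq_of_nhds
  simp only [waveOp_eq_dirDeriv hf, waveOp_eq_dirDeriv hg, h2]

/-! ### Differentiation of weighted superpositions of translates. -/

section shiftIntegral

variable {α E F : Type} [MeasurableSpace α] {μ : Measure α} [NormedAddCommGroup E]
  [MeasurableSpace E] [BorelSpace E] [NormedAddCommGroup F] [NormedSpace ℝ F]
  {w : α → ℝ} {L : α → E}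

/-- If `‖p‖ ≤ R` and `f` is supported in the ball of radius `S`, only parameters with `‖L a‖ ≤ R +
S` contribute. Local integrability of the weight along `L` therefore gives a bound uniform in `p`.
-/
theorem exists_integrable_bound_of_hasCompactSupport {f : E → F}
    (hw : ∀ R, IntegrableOn w {a | ‖L a‖ ≤ R} μ) (hL : Measurable L)
    (hf : Continuous f) (hc : HasCompactSupport f) (R : ℝ) :
    ∃ b : α → ℝ, Integrable b μ ∧ ∀ a, ∀ p : E, ‖p‖ ≤ R → ‖w a • f (p + L a)‖ ≤ b a := by
  obtain ⟨M, hM⟩ := hc.exists_bound_of_continuous hf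
  obtain ⟨S, hS⟩ := hc.isCompact.isBounded.subset_closedBall (0 : E)
  refine ⟨indicator {a | ‖L a‖ ≤ R + S} fun a => ‖w a‖ * M, ?_, fun a p hp => ?_⟩
  · exact (integrable_indicator_iff (measurableSet_le hL.norm measurable_const)).2
      ((hw _).norm.mul_const M)
  · by_cases ha : ‖L a‖ ≤ R + S
    · rw [indicator_of_mem (by exact ha), norm_smul]
      gcongr
      exact hM _
    · rw [indicator_of_notMem (by exact ha)]
      have : f (p + L a) = 0 := by
        by_contra h
        have h1 := hS (subset_tsupport _ h)
        rw [mem_closedBall_zero_iff] at h1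
        have := norm_sub_le (p + L a) p
        rw [add_sub_cancel_left] at this
        exact ha (by linarith)
      simp [this]

theorem aestronglyMeasurable_smul_comp_add [SecondCountableTopology E] {f : E → F}
    (hwm : AEStronglyMeasurable w μ) (hL : Measurable L) (hf : Continuous f) (p : E) :
    AEStronglyMeasurable (fun a => w a • f (p + L a)) μ :=
  hwm.smul ((hf.comp (continuous_const.add continuous_id)).comp_aestronglyMeasurable
    hL.aestronglyMeasurable)

variable [NormedSpace ℝ E] [SecondCountableTopology E]

theorem hasFDerivAt_integral_smul_comp_add {f : E → F}
    (hw : ∀ R, IntegrableOn w {a | ‖L a‖ ≤ R} μ) (hwm : AEStronglyMeasurable w μ)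
    (hL : Measurable L) (hf : ContDiff ℝ 1 f) (hc : HasCompactSupport f) (p : E) :
    HasFDerivAt (fun q => ∫ a, w a • f (q + L a) ∂μ)
      (∫ a, w a • fderiv ℝ f (p + L a) ∂μ) p := by
  obtain ⟨b₀, hb₀, hb₀'⟩ :=
    exists_integrable_bound_of_hasCompactSupport hw hL hf.continuous hc ‖p‖
  obtain ⟨b, hb, hb'⟩ := exists_integrable_bound_of_hasCompactSupport hw hL
    (hf.continuous_fderiv one_ne_zero) (hc.fderiv ℝ) (‖p‖ + 1)
  refine hasFDerivAt_integral_of_dominated_of_fderiv_le (F := fun q a => w a • f (q + L a))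
    (F' := fun q a => w a • fderiv ℝ f (q + L a)) (bound := b)
    (Metric.ball_mem_nhds p one_pos)
    (Filter.Eventually.of_forall fun q =>
      aestronglyMeasurable_smul_comp_add hwm hL hf.continuous q)
    (hb₀.mono' (aestronglyMeasurable_smul_comp_add hwm hL hf.continuous p)
      (Filter.Eventually.of_forall fun a => hb₀' a p le_rfl))
    (aestronglyMeasurable_smul_comp_add hwm hL (hf.continuous_fderiv one_ne_zero) p)
    (Filter.Eventually.of_forall fun a q hq => hb' a q ?_) hb
    (Filter.Eventually.of_forall fun a q _ => ?_)
  · have := norm_sub_norm_le q p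
    rw [Metric.mem_ball, dist_eq_norm] at hq
    linarith
  · have h1 := ((hf.differentiable one_ne_zero) (q + L a)).hasFDerivAt
    exact (h1.comp q ((hasFDerivAt_id q).add_const (L a))).const_smul (w a)

/-- The derivative is an integral of the same kind with `fderiv ℝ f` in place of `f`; the codomain
is quantified inside the induction because it changes at each step. -/
theorem contDiff_integral_smul_comp_add
    (hw : ∀ R, IntegrableOn w {a | ‖L a‖ ≤ R} μ) (hwm : AEStronglyMeasurable w μ)
    (hL : Measurable L) (n : ℕ) : ∀ {F : Type} [NormedAddCommGroup F] [NormedSpace ℝ F]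
    {f : E → F}, ContDiff ℝ ∞ f → HasCompactSupport f →
    ContDiff ℝ n (fun q => ∫ a, w a • f (q + L a) ∂μ) := by
  induction n with
  | zero =>
    intro F _ _ f hf hc
    have h := fun p => hasFDerivAt_integral_smul_comp_add hw hwm hL (hf.of_le (by simp)) hc p
    exact contDiff_zero.2 (continuous_iff_continuousAt.2 fun p => (h p).continuousAt)
  | succ n ih =>
    intro F _ _ f hf hc
    have h := fun p => hasFDerivAt_integral_smul_comp_add hw hwm hL (hf.of_le (by simp)) hc p
    push_cast
    rw [contDiff_succ_iff_fderiv]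
    refine ⟨fun p => (h p).differentiableAt, by simp, ?_⟩
    rw [show fderiv ℝ (fun q => ∫ a, w a • f (q + L a) ∂μ)
      = fun q => ∫ a, w a • fderiv ℝ f (q + L a) ∂μ from funext fun p => (h p).fderiv]
    exact ih (hf.fderiv_right (by simp)) (hc.fderiv ℝ)

end shiftIntegral

/-! ### The advanced potential. -/

theorem integrableOn_norm_inv_rpow {α : ℝ} (hα : α < 3) (R : ℝ) :
    IntegrableOn (fun h : R3 => ‖h‖ ^ (-α)) (Metric.closedBall 0 R) := by
  refine (locallyIntegrable_of_norm_le_rpow (E := R3) (C := 1) (α := α) (by simp) (by simpa)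
    (Filter.Eventually.of_forall fun x => ?_)
    ?_).integrableOn_isCompact (isCompact_closedBall 0 R)
  · rw [one_mul, Real.norm_of_nonneg (by positivity)]
  · exact (measurable_norm.pow_const _).aestronglyMeasurable

/-- The density `1 / (4 π ‖h‖)` of the fundamental solution on the light cone. -/
noncomputable def coneWeight (h : R3) : ℝ := 1 / (4 * Real.pi * ‖h‖)

/-- The point of the future light cone of the origin over `h`. -/
noncomputable def conePoint (c : ℝ) (h : R3) : R3 × ℝ := (h, ‖h‖ / c)

theorem integrableOn_norm_inv (R : ℝ) :
    IntegrableOn (fun h : R3 => ‖h‖⁻¹) (Metric.closedBall 0 R) := by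
  simpa [Real.rpow_neg_one] using integrableOn_norm_inv_rpow (α := 1) (by norm_num) R

theorem integrableOn_norm_inv_sq (R : ℝ) :
    IntegrableOn (fun h : R3 => (‖h‖ ^ 2)⁻¹) (Metric.closedBall 0 R) := by
  refine (integrableOn_norm_inv_rpow (α := 2) (by norm_num) R).congr_fun (fun x _ => ?_)
    measurableSet_closedBall
  simp only
  rw [Real.rpow_neg (norm_nonneg _)]
  norm_cast

theorem measurable_coneWeight : Measurable coneWeight := by
  unfold coneWeight; fun_prop

theorem continuous_conePoint (c : ℝ) : Continuous (conePoint c) := by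
  unfold conePoint; fun_prop

theorem integrableOn_coneWeight (c R : ℝ) :
    IntegrableOn coneWeight {h | ‖conePoint c h‖ ≤ R} := by
  have h : IntegrableOn coneWeight (Metric.closedBall 0 R) := by
    refine ((integrableOn_norm_inv R).const_mul (1 / (4 * Real.pi))).congr
      (Filter.Eventually.of_forall fun x => ?_)
    simp only [coneWeight]
    simp only [one_div, mul_inv]
  refine h.mono_set fun x hx => ?_
  rw [mem_closedBall_zero_iff]
  exact (le_max_left _ _).trans hx

/-- The advanced potential of `ψ`. -/
noncomputable def advancedPotential (c : ℝ) (ψ : R3 × ℝ → ℝ) (p : R3 × ℝ) : ℝ :=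
  ∫ h, coneWeight h • ψ (p + conePoint c h)

section advancedPotential

variable {c : ℝ} {ψ : R3 × ℝ → ℝ}

theorem contDiff_advancedPotential (hψ : ContDiff ℝ ∞ ψ) (hc : HasCompactSupport ψ) :
    ContDiff ℝ ∞ (advancedPotential c ψ) :=
  contDiff_infty.2 fun n => contDiff_integral_smul_comp_add (integrableOn_coneWeight c)
    measurable_coneWeight.aestronglyMeasurable (continuous_conePoint c).measurable n hψ hc

theorem integrable_coneWeight_smul (hψ : Continuous ψ) (hc : HasCompactSupport ψ)
    (p : R3 × ℝ) : Integrable fun h => coneWeight h • ψ (p + conePoint c h) := by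
  obtain ⟨b, hb, hb'⟩ := exists_integrable_bound_of_hasCompactSupport (integrableOn_coneWeight c)
    (continuous_conePoint c).measurable hψ hc ‖p‖
  exact hb.mono' (aestronglyMeasurable_smul_comp_add measurable_coneWeight.aestronglyMeasurable
    (continuous_conePoint c).measurable hψ p) (Filter.Eventually.of_forall fun a => hb' a p le_rfl)

theorem dirDeriv_advancedPotential (hψ : ContDiff ℝ ∞ ψ) (hc : HasCompactSupport ψ)
    (v : R3 × ℝ) :
    dirDeriv v (advancedPotential c ψ) = advancedPotential c (dirDeriv v ψ) := by
  ext p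
  have h := hasFDerivAt_integral_smul_comp_add (integrableOn_coneWeight c)
    measurable_coneWeight.aestronglyMeasurable (continuous_conePoint c).measurable
    (hψ.of_le (by simp)) hc p
  obtain ⟨b, hb, hb'⟩ := exists_integrable_bound_of_hasCompactSupport (integrableOn_coneWeight c)
    (continuous_conePoint c).measurable (hψ.continuous_fderiv (by simp)) (hc.fderiv ℝ) ‖p‖
  have hi : Integrable fun a => coneWeight a • fderiv ℝ ψ (p + conePoint c a) :=
    hb.mono' (aestronglyMeasurable_smul_comp_add measurable_coneWeight.aestronglyMeasurable
      (continuous_conePoint c).measurable (hψ.continuous_fderiv (by simp)) p)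
      (Filter.Eventually.of_forall fun a => hb' a p le_rfl)
  change fderiv ℝ (fun q => ∫ a, coneWeight a • ψ (q + conePoint c a)) p v = _
  rw [h.fderiv, ContinuousLinearMap.integral_apply hi]
  simp [advancedPotential, dirDeriv]

/-- The weight and the cone do not depend on `p`, so all derivatives fall on `ψ`. -/
theorem waveOp_advancedPotential (hψ : ContDiff ℝ ∞ ψ) (hc : HasCompactSupport ψ)
    (p : R3 × ℝ) :
    waveOp c (advancedPotential c ψ) p = ∫ h, coneWeight h * waveOp c ψ (p + conePoint c h) := by
  have h2 : ∀ v, dirDeriv v (dirDeriv v (advancedPotential c ψ)) p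
      = ∫ h, coneWeight h • dirDeriv v (dirDeriv v ψ) (p + conePoint c h) := fun v => by
    rw [dirDeriv_advancedPotential hψ hc, dirDeriv_advancedPotential (hψ.dirDeriv v)
      (hc.dirDeriv v), advancedPotential]
  have hi : ∀ v, Integrable fun h =>
      coneWeight h • dirDeriv v (dirDeriv v ψ) (p + conePoint c h) := fun v =>
    integrable_coneWeight_smul ((hψ.dirDeriv v).dirDeriv v).continuous
      ((hc.dirDeriv v).dirDeriv v) p
  simp only [waveOp_eq_dirDeriv (contDiff_advancedPotential hψ hc), h2, waveOp_eq_dirDeriv hψ]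
  rw [← integral_finsetSum _ fun i _ => hi _, ← integral_const_mul,
    ← integral_sub ((hi _).const_mul _) (integrable_finsetSum _ fun i _ => hi _)]
  congr 1 with h
  simp only [smul_eq_mul, mul_sub, Finset.mul_sum]
  ring

end advancedPotential

/-! ### Integration by parts on a hyperboloid approximating the light cone. -/

/-- The inverse of the regularised radius `√(‖h‖² + η²)`. -/
noncomputable def regInv (η : ℝ) (h : R3) : ℝ := (√(‖h‖ ^ 2 + η ^ 2))⁻¹

/-- The point over `h` of the hyperboloid that approximates the future light cone. -/
noncomputable def hyperPoint (c η : ℝ) (h : R3) : R3 × ℝ := (h, √(‖h‖ ^ 2 + η ^ 2) / c)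

section regularisation

variable {c η : ℝ} {f : R3 × ℝ → ℝ}

theorem regInv_nonneg (η : ℝ) (h : R3) : 0 ≤ regInv η h := by
  unfold regInv; positivity

theorem sq_mul_regInv_sq (hη : 0 < η) (h : R3) :
    (‖h‖ ^ 2 + η ^ 2) * regInv η h ^ 2 = 1 := by
  have : 0 < ‖h‖ ^ 2 + η ^ 2 := by positivity
  rw [regInv, inv_pow, Real.sq_sqrt this.le, mul_inv_cancel₀ this.ne']

theorem regInv_le (η : ℝ) {h : R3} (hh : h ≠ 0) : regInv η h ≤ ‖h‖⁻¹ := by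
  unfold regInv
  have := norm_pos_iff.2 hh
  gcongr
  exact Real.le_sqrt_of_sq_le (by nlinarith [sq_nonneg η])

theorem sq_mul_regInv_sq_le_one (hη : 0 < η) (h : R3) : η ^ 2 * regInv η h ^ 2 ≤ 1 := by
  rw [← sq_mul_regInv_sq hη h]
  gcongr
  nlinarith [sq_nonneg ‖h‖]

theorem continuous_regInv (hη : 0 < η) : Continuous (regInv η) := by
  unfold regInv
  refine Continuous.inv₀ (by fun_prop) fun x => ?_
  positivity

theorem continuous_hyperPoint (c η : ℝ) : Continuous (hyperPoint c η) := by
  unfold hyperPoint; fun_prop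

theorem HasCompactSupport.comp_hyperPoint (hf : HasCompactSupport f) (c η : ℝ) :
    HasCompactSupport fun h => f (hyperPoint c η h) :=
  HasCompactSupport.intro (hf.isCompact.image continuous_fst) fun h hh => by
    by_contra h0
    exact hh ⟨_, subset_tsupport _ h0, rfl⟩

theorem tendsto_regInv {h : R3} (hh : h ≠ 0) :
    Tendsto (fun η => regInv η h) (𝓝[>] 0) (𝓝 ‖h‖⁻¹) := by
  have h0 := norm_pos_iff.2 hh
  have : ContinuousAt (fun η => regInv η h) 0 := by
    unfold regInv
    refine ContinuousAt.inv₀ (by fun_prop) ?_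
    simpa using hh
  have h2 := this.tendsto
  simp only [regInv] at h2 ⊢
  rw [zero_pow two_ne_zero, add_zero, Real.sqrt_sq h0.le] at h2
  exact h2.mono_left nhdsWithin_le_nhds

theorem tendsto_hyperPoint (c : ℝ) (h : R3) :
    Tendsto (fun η => hyperPoint c η h) (𝓝[>] 0) (𝓝 (conePoint c h)) := by
  have : Continuous (fun η => hyperPoint c η h) := by unfold hyperPoint; fun_prop
  have h2 := this.tendsto 0
  simp only [hyperPoint] at h2 ⊢
  rw [zero_pow two_ne_zero, add_zero, Real.sqrt_sq (norm_nonneg h)] at h2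
  exact h2.mono_left nhdsWithin_le_nhds

theorem hasDerivAt_sqrt_add_smul_single (hη : 0 < η) (h : R3) (i : Fin 3) :
    HasDerivAt (fun t : ℝ => √(‖h + t • EuclideanSpace.single i (1 : ℝ)‖ ^ 2 + η ^ 2))
      (h i * regInv η h) 0 := by
  have h1 : HasDerivAt (fun t : ℝ => h + t • (EuclideanSpace.single i (1 : ℝ) : R3))
      (EuclideanSpace.single i (1 : ℝ)) 0 := by
    simpa using ((hasDerivAt_id (0 : ℝ)).smul_const
      (EuclideanSpace.single i (1 : ℝ) : R3)).const_add h
  have h2 := (h1.norm_sq.add_const (η ^ 2)).sqrt (by positivity)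
  convert! h2 using 1
  simp only [zero_smul, add_zero, regInv]
  have : inner ℝ h (EuclideanSpace.single i (1 : ℝ)) = h i := by
    simp [EuclideanSpace.inner_single_right]
  rw [this]
  field_simp

theorem hasDerivAt_regInv_add_smul_single (hη : 0 < η) (h : R3) (i : Fin 3) :
    HasDerivAt (fun t : ℝ => regInv η (h + t • EuclideanSpace.single i (1 : ℝ)))
      (-(h i * regInv η h ^ 3)) 0 := by
  have h1 := (hasDerivAt_sqrt_add_smul_single hη h i).inv (by positivity)
  convert! h1 using 1
  simp only [zero_smul, add_zero, regInv]
  field_simp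

theorem hasDerivAt_comp_hyperPoint (hη : 0 < η) (hf : ContDiff ℝ ∞ f) (h : R3) (i : Fin 3) :
    HasDerivAt (fun t : ℝ => f (hyperPoint c η (h + t • EuclideanSpace.single i (1 : ℝ))))
      (dirDeriv (spaceDir i) f (hyperPoint c η h)
        + c⁻¹ * h i * regInv η h * dirDeriv timeDir f (hyperPoint c η h)) 0 := by
  have h1 : HasDerivAt (fun t : ℝ => h + t • (EuclideanSpace.single i (1 : ℝ) : R3))
      (EuclideanSpace.single i (1 : ℝ)) 0 := by
    simpa using ((hasDerivAt_id (0 : ℝ)).smul_const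
      (EuclideanSpace.single i (1 : ℝ) : R3)).const_add h
  have h2 := h1.prodMk ((hasDerivAt_sqrt_add_smul_single hη h i).div_const c)
  have h3 := ((hf.differentiable (by simp)) _).hasFDerivAt.comp_hasDerivAt 0 h2
  have h4 : ((EuclideanSpace.single i (1 : ℝ), h i * regInv η h / c) : R3 × ℝ)
      = spaceDir i + (c⁻¹ * h i * regInv η h) • timeDir := by
    ext <;> simp
    ring
  rw [h4, map_add, map_smul] at h3
  simpa [dirDeriv, hyperPoint, Function.comp_def] using h3

/-- The integral of a partial derivative of a compactly supported function vanishes. -/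
theorem integral_eq_zero_of_hasLineDerivAt {X Y : R3 → ℝ} {v : R3} (hX : Integrable X)
    (hY : Integrable Y) (h : ∀ x, HasLineDerivAt ℝ X (Y x) x v) : ∫ x, Y x = 0 := by
  have := integral_bilinear_hasLineDerivAt_right_eq_neg_left_of_integrable (μ := volume)
    (f := fun _ : R3 => (1 : ℝ)) (f' := fun _ => 0) (g := X) (g' := Y) (v := v)
    (B := ContinuousLinearMap.mul ℝ ℝ) (by simp) (by simpa using hY) (by simpa using hX)
    (fun x _ => by simpa using (hasFDerivAt_const (1 : ℝ) x).hasLineDerivAt v) (fun x _ => h x)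
  simpa using this

/-- With `s = regInv η h`, the integrand is the `i`-th partial derivative in `h` of `s ∂ᵢf - c⁻¹ hᵢ
s² ∂ₜf + hᵢ s³ f`, taken on the hyperboloid. The last two terms are chosen to cancel the mixed
derivative `∂ₜ∂ᵢf` and the term in `∂ᵢf` produced by the first. -/
theorem integral_divergence_component (hη : 0 < η) (hf : ContDiff ℝ ∞ f)
    (hc : HasCompactSupport f) (i : Fin 3) :
    ∫ h, (dirDeriv (spaceDir i) (dirDeriv (spaceDir i) f) (hyperPoint c η h) * regInv η h
      - c⁻¹ * dirDeriv timeDir f (hyperPoint c η h) * regInv η h ^ 2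
      - c⁻¹ ^ 2 * h i ^ 2 * dirDeriv timeDir (dirDeriv timeDir f) (hyperPoint c η h)
        * regInv η h ^ 3
      + 3 * c⁻¹ * h i ^ 2 * dirDeriv timeDir f (hyperPoint c η h) * regInv η h ^ 4
      + f (hyperPoint c η h) * regInv η h ^ 3
      - 3 * h i ^ 2 * f (hyperPoint c η h) * regInv η h ^ 5) = 0 ∧
    Integrable fun h => (dirDeriv (spaceDir i) (dirDeriv (spaceDir i) f) (hyperPoint c η h)
        * regInv η h
      - c⁻¹ * dirDeriv timeDir f (hyperPoint c η h) * regInv η h ^ 2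
      - c⁻¹ ^ 2 * h i ^ 2 * dirDeriv timeDir (dirDeriv timeDir f) (hyperPoint c η h)
        * regInv η h ^ 3
      + 3 * c⁻¹ * h i ^ 2 * dirDeriv timeDir f (hyperPoint c η h) * regInv η h ^ 4
      + f (hyperPoint c η h) * regInv η h ^ 3
      - 3 * h i ^ 2 * f (hyperPoint c η h) * regInv η h ^ 5) := by
  have hint : ∀ g : R3 × ℝ → ℝ, ContDiff ℝ ∞ g → HasCompactSupport g → ∀ k : R3 → ℝ,
      Continuous k → Integrable fun h => g (hyperPoint c η h) * k h := fun g hg hgc k hk =>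
    ((hg.continuous.comp (continuous_hyperPoint c η)).mul hk).integrable_of_hasCompactSupport
      (hgc.comp_hyperPoint c η).mul_right
  have hs := continuous_regInv hη
  have hi : Continuous fun h : R3 => h i := by fun_prop
  have hY : Integrable fun h => (dirDeriv (spaceDir i) (dirDeriv (spaceDir i) f)
        (hyperPoint c η h) * regInv η h
      - c⁻¹ * dirDeriv timeDir f (hyperPoint c η h) * regInv η h ^ 2
      - c⁻¹ ^ 2 * h i ^ 2 * dirDeriv timeDir (dirDeriv timeDir f) (hyperPoint c η h)
        * regInv η h ^ 3
      + 3 * c⁻¹ * h i ^ 2 * dirDeriv timeDir f (hyperPoint c η h) * regInv η h ^ 4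
      + f (hyperPoint c η h) * regInv η h ^ 3
      - 3 * h i ^ 2 * f (hyperPoint c η h) * regInv η h ^ 5) := by
    refine ((((( hint _ ((hf.dirDeriv (spaceDir i)).dirDeriv (spaceDir i))
      ((hc.dirDeriv _).dirDeriv _) (regInv η) hs).sub
      (hint _ (hf.dirDeriv timeDir) (hc.dirDeriv _) (fun h => c⁻¹ * regInv η h ^ 2)
        (by fun_prop))).sub
      (hint _ ((hf.dirDeriv timeDir).dirDeriv timeDir) ((hc.dirDeriv _).dirDeriv _)
        (fun h => c⁻¹ ^ 2 * h i ^ 2 * regInv η h ^ 3) (by fun_prop))).add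
      (hint _ (hf.dirDeriv timeDir) (hc.dirDeriv _)
        (fun h => 3 * c⁻¹ * h i ^ 2 * regInv η h ^ 4) (by fun_prop))).add
      (hint _ hf hc (fun h => regInv η h ^ 3) (by fun_prop))).sub
      (hint _ hf hc (fun h => 3 * h i ^ 2 * regInv η h ^ 5) (by fun_prop)) |>.congr
      (Eventually.of_forall fun h => ?_)
    simp only [Pi.add_apply, Pi.sub_apply]
    ring
  refine ⟨integral_eq_zero_of_hasLineDerivAt (v := EuclideanSpace.single i (1 : ℝ))
    (X := fun h => dirDeriv (spaceDir i) f (hyperPoint c η h) * regInv η h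
      - c⁻¹ * (h i * dirDeriv timeDir f (hyperPoint c η h)) * regInv η h ^ 2
      + h i * f (hyperPoint c η h) * regInv η h ^ 3) ?_ hY fun h => ?_, hY⟩
  · refine ((hint _ (hf.dirDeriv (spaceDir i)) (hc.dirDeriv _) (regInv η) hs).sub
      (hint _ (hf.dirDeriv timeDir) (hc.dirDeriv _)
        (fun h => c⁻¹ * h i * regInv η h ^ 2) (by fun_prop))).add
      (hint _ hf hc (fun h => h i * regInv η h ^ 3) (by fun_prop)) |>.congr
      (Eventually.of_forall fun h => ?_)
    simp only [Pi.add_apply, Pi.sub_apply]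
    ring
  · have ds := hasDerivAt_regInv_add_smul_single hη h i
    have dA := hasDerivAt_comp_hyperPoint (c := c) hη (hf.dirDeriv (spaceDir i)) h i
    have dB := hasDerivAt_comp_hyperPoint (c := c) hη (hf.dirDeriv timeDir) h i
    have dP := hasDerivAt_comp_hyperPoint (c := c) hη hf h i
    have dx : HasDerivAt (fun t : ℝ => (h + t • EuclideanSpace.single i (1 : ℝ)) i) 1 0 := by
      simpa using (hasDerivAt_id (0 : ℝ)).const_add (h i)
    have := ((dA.mul ds).sub (((dx.mul dB).const_mul c⁻¹).mul (ds.pow 2))).add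
      ((dx.mul dP).mul (ds.pow 3))
    unfold HasLineDerivAt
    convert! this using 1
    simp only [zero_smul, add_zero, Pi.mul_apply, Pi.pow_apply]
    rw [dirDeriv_comm hf timeDir (spaceDir i)]
    push_cast
    ring

/-- Summing the three components and substituting `‖h‖² s² = 1 - η² s²` with `s = regInv η h`,
everything of order zero in `η` assembles into `-s · waveOp c f`, and the remainders all carry a
factor `η²`. -/
theorem integral_waveOp_hyperPoint (hη : 0 < η) (hf : ContDiff ℝ ∞ f)
    (hc : HasCompactSupport f) :
    ∫ h, regInv η h * waveOp c f (hyperPoint c η h)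
      = c⁻¹ ^ 2 * (∫ h, η ^ 2 * regInv η h ^ 3
          * dirDeriv timeDir (dirDeriv timeDir f) (hyperPoint c η h))
        - 3 * c⁻¹ * (∫ h, η ^ 2 * regInv η h ^ 4 * dirDeriv timeDir f (hyperPoint c η h))
        + ∫ h, 3 * η ^ 2 * regInv η h ^ 5 * f (hyperPoint c η h) := by
  have hint : ∀ g : R3 × ℝ → ℝ, ContDiff ℝ ∞ g → HasCompactSupport g → ∀ k : R3 → ℝ,
      Continuous k → Integrable fun h => k h * g (hyperPoint c η h) := fun g hg hgc k hk =>
    (hk.mul (hg.continuous.comp (continuous_hyperPoint c η))).integrable_of_hasCompactSupport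
      (hgc.comp_hyperPoint c η).mul_left
  have hs := continuous_regInv hη
  have hsum := Finset.sum_eq_zero fun i (_ : i ∈ (Finset.univ : Finset (Fin 3))) =>
    (integral_divergence_component (c := c) hη hf hc i).1
  rw [← integral_finsetSum _ fun i _ => (integral_divergence_component hη hf hc i).2] at hsum
  have i1 := hint _ ((hf.dirDeriv timeDir).dirDeriv timeDir) ((hc.dirDeriv _).dirDeriv _)
    (fun h => η ^ 2 * regInv η h ^ 3) (by fun_prop)
  have i2 := hint _ (hf.dirDeriv timeDir) (hc.dirDeriv _)
    (fun h => η ^ 2 * regInv η h ^ 4) (by fun_prop)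
  have i3 := hint _ hf hc (fun h => 3 * η ^ 2 * regInv η h ^ 5) (by fun_prop)
  have i12 : Integrable fun h => c⁻¹ ^ 2 * (η ^ 2 * regInv η h ^ 3
        * dirDeriv timeDir (dirDeriv timeDir f) (hyperPoint c η h))
      - 3 * c⁻¹ * (η ^ 2 * regInv η h ^ 4 * dirDeriv timeDir f (hyperPoint c η h)) :=
    (i1.const_mul _).sub (i2.const_mul _)
  have i123 : Integrable fun h => c⁻¹ ^ 2 * (η ^ 2 * regInv η h ^ 3
        * dirDeriv timeDir (dirDeriv timeDir f) (hyperPoint c η h))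
      - 3 * c⁻¹ * (η ^ 2 * regInv η h ^ 4 * dirDeriv timeDir f (hyperPoint c η h))
      + 3 * η ^ 2 * regInv η h ^ 5 * f (hyperPoint c η h) := i12.add i3
  rw [← integral_const_mul, ← integral_const_mul,
    ← integral_sub (i1.const_mul _) (i2.const_mul _), ← integral_add i12 i3, ← sub_eq_zero,
    ← integral_sub ?_ i123, ← neg_eq_zero, ← integral_neg, ← hsum]
  · congr 1 with h
    have hn : ‖h‖ ^ 2 = h 0 ^ 2 + h 1 ^ 2 + h 2 ^ 2 := by
      rw [EuclideanSpace.norm_sq_eq, Fin.sum_univ_three]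
      simp
    have h1 := sq_mul_regInv_sq hη h
    rw [hn] at h1
    rw [waveOp_eq_dirDeriv hf, Fin.sum_univ_three, Fin.sum_univ_three]
    generalize regInv η h = s at *
    simp only [one_div, inv_pow]
    linear_combination
      (((c ^ 2)⁻¹ * s * dirDeriv timeDir (dirDeriv timeDir f) (hyperPoint c η h))
      - 3 * c⁻¹ * s ^ 2 * dirDeriv timeDir f (hyperPoint c η h)
      + 3 * s ^ 3 * f (hyperPoint c η h)) * h1
  · refine ((hint _ ((hf.dirDeriv timeDir).dirDeriv timeDir) ((hc.dirDeriv _).dirDeriv _)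
      (fun h => 1 / c ^ 2 * regInv η h) (by fun_prop)).sub
      (integrable_finsetSum Finset.univ fun i _ =>
        hint _ ((hf.dirDeriv (spaceDir i)).dirDeriv (spaceDir i)) ((hc.dirDeriv _).dirDeriv _)
      (regInv η) hs)).congr (Eventually.of_forall fun h => ?_)
    simp only [Pi.sub_apply, waveOp_eq_dirDeriv hf, ← Finset.mul_sum]
    ring

end regularisation

/-! ### The limit from the hyperboloid to the cone. -/

/-- Dominated convergence: the compact support of `f` confines `h` to a ball independent of `η`,
where `B` is integrable. The vertex `h = 0` is a null set. -/
theorem tendsto_integral_kernel_comp_hyperPoint {c : ℝ} {f : R3 × ℝ → ℝ} (hf : Continuous f)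
    (hc : HasCompactSupport f) {K : ℝ → R3 → ℝ} {K₀ B : R3 → ℝ}
    (hK : ∀ η, 0 < η → Continuous (K η))
    (hB : ∀ R, IntegrableOn B (Metric.closedBall 0 R))
    (hKB : ∀ η, 0 < η → ∀ h, h ≠ 0 → ‖K η h‖ ≤ B h)
    (hK₀ : ∀ h, h ≠ 0 → Tendsto (fun η => K η h) (𝓝[>] 0) (𝓝 (K₀ h))) :
    Tendsto (fun η => ∫ h, K η h * f (hyperPoint c η h)) (𝓝[>] 0)
      (𝓝 (∫ h, K₀ h * f (conePoint c h))) := by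
  obtain ⟨M, hM⟩ := hc.exists_bound_of_continuous hf
  obtain ⟨S, hS⟩ := hc.isCompact.isBounded.subset_closedBall (0 : R3 × ℝ)
  have h0 : ∀ᵐ h : R3, h ≠ 0 := by simp [ae_iff]
  refine tendsto_integral_filter_of_dominated_convergence
    (indicator (Metric.closedBall 0 S) fun h => B h * M) ?_ ?_
    ((integrable_indicator_iff measurableSet_closedBall).2 ((hB S).mul_const M)) ?_
  · filter_upwards [self_mem_nhdsWithin] with η hη
    exact ((hK η hη).mul (hf.comp (continuous_hyperPoint c η))).aestronglyMeasurable
  · filter_upwards [self_mem_nhdsWithin] with η hη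
    filter_upwards [h0] with h hh
    by_cases hm : h ∈ Metric.closedBall (0 : R3) S
    · rw [indicator_of_mem hm, norm_mul]
      exact mul_le_mul (hKB η hη h hh) (hM _) (norm_nonneg _)
        ((norm_nonneg _).trans (hKB η hη h hh))
    · rw [indicator_of_notMem hm]
      have : f (hyperPoint c η h) = 0 := by
        by_contra hne
        have h1 := hS (subset_tsupport _ hne)
        rw [mem_closedBall_zero_iff] at h1 hm
        exact hm ((le_max_left _ _).trans h1)
      simp [this]
  · filter_upwards [h0] with h hh
    exact (hK₀ h hh).mul (hf.continuousAt.tendsto.comp (tendsto_hyperPoint c h))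

theorem regInv_one_norm (h : R3) : regInv 1 h = (√(‖h‖ ^ 2 + 1))⁻¹ := by
  simp [regInv]

/-- This is an explicit primitive of the radial density of `3 (‖k‖² + 1)^(-5/2)`. It runs from `0`
to `1`, so the integral over space is three times the volume of the unit ball, that is `4π`. -/
theorem hasDerivAt_cube_mul_inv_sqrt (y : ℝ) :
    HasDerivAt (fun y : ℝ => y ^ 3 * (√(y ^ 2 + 1))⁻¹ ^ 3)
      (y ^ 2 * (3 * (√(y ^ 2 + 1))⁻¹ ^ 5)) y := by
  have hp : 0 < y ^ 2 + 1 := by positivity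
  have h1 : HasDerivAt (fun y : ℝ => √(y ^ 2 + 1)) (2 * y / (2 * √(y ^ 2 + 1))) y := by
    simpa using (((hasDerivAt_id y).pow 2).add_const 1).sqrt hp.ne'
  have h2 := ((hasDerivAt_id y).pow 3).mul ((h1.inv (by positivity)).pow 3)
  convert! h2 using 1
  have hs := Real.sq_sqrt hp.le
  have hs0 := (Real.sqrt_pos.2 hp).ne'
  simp only [id, Pi.pow_apply, Pi.inv_apply]
  generalize √(y ^ 2 + 1) = s at *
  have e : -(2 * y / (2 * s)) / s ^ 2 = -(y * s⁻¹ ^ 3) := by field_simp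
  have e2 : (y ^ 2 + 1) * s⁻¹ ^ 2 = 1 := by rw [← hs]; field_simp
  rw [e]
  push_cast
  linear_combination (3 * y ^ 2 * s⁻¹ ^ 3) * e2

theorem tendsto_cube_mul_inv_sqrt :
    Tendsto (fun y : ℝ => y ^ 3 * (√(y ^ 2 + 1))⁻¹ ^ 3) atTop (𝓝 1) := by
  have h1 : Tendsto (fun y : ℝ => (y ^ 2 + 1)⁻¹) atTop (𝓝 0) :=
    tendsto_inv_atTop_zero.comp
      (tendsto_atTop_add_const_right _ _ (tendsto_pow_atTop two_ne_zero))
  have h2 : Tendsto (fun y : ℝ => √(1 - (y ^ 2 + 1)⁻¹) ^ 3) atTop (𝓝 1) := by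
    have : Continuous fun x : ℝ => √(1 - x) ^ 3 := by fun_prop
    simpa [Function.comp_def] using (this.tendsto 0).comp h1
  refine h2.congr' ?_
  filter_upwards [eventually_ge_atTop 0] with y hy
  rw [← mul_pow]
  congr 1
  have : 1 - (y ^ 2 + 1)⁻¹ = y ^ 2 / (y ^ 2 + 1) := by
    have : y ^ 2 + 1 ≠ 0 := by positivity
    field_simp
    ring
  rw [this, Real.sqrt_div (sq_nonneg y), Real.sqrt_sq hy, div_eq_mul_inv]

theorem integrable_regInv_one_pow_five : Integrable fun k : R3 => 3 * regInv 1 k ^ 5 := by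
  simp only [regInv_one_norm]
  rw [integrable_fun_norm_addHaar volume (f := fun y : ℝ => 3 * (√(y ^ 2 + 1))⁻¹ ^ 5)]
  simp only [finrank_euclideanSpace, Fintype.card_fin, smul_eq_mul]
  exact integrableOn_Ioi_deriv_of_nonneg' (g' := fun y : ℝ => y ^ 2 * (3 * (√(y ^ 2 + 1))⁻¹ ^ 5))
    (fun y _ => hasDerivAt_cube_mul_inv_sqrt y) (fun y _ => by positivity) tendsto_cube_mul_inv_sqrt

theorem integral_regInv_one_pow_five : ∫ k : R3, 3 * regInv 1 k ^ 5 = 4 * Real.pi := by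
  simp only [regInv_one_norm]
  rw [integral_fun_norm_addHaar volume (fun y : ℝ => 3 * (√(y ^ 2 + 1))⁻¹ ^ 5)]
  simp only [finrank_euclideanSpace, Fintype.card_fin, smul_eq_mul]
  have := integral_Ioi_of_hasDerivAt_of_nonneg' (a := 0)
    (fun y _ => hasDerivAt_cube_mul_inv_sqrt y)
    (fun y _ => by positivity) tendsto_cube_mul_inv_sqrt
  simp only [Nat.add_one_sub_one] at this ⊢
  rw [this, measureReal_def, EuclideanSpace.volume_ball_fin_three]
  simp only [ENNReal.ofReal_one, one_pow, one_mul, zero_pow three_ne_zero, zero_mul, sub_zero,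
    mul_one, nsmul_eq_mul]
  rw [ENNReal.toReal_ofReal (by positivity)]
  push_cast
  ring

/-- The kernel is an approximate identity of mass `4π`: the substitution `h = η k` removes `η` from
it and leaves `f (η • hyperPoint c 1 k)`, which tends to `f 0`. -/
theorem tendsto_integral_regInv_pow_five {c : ℝ} {f : R3 × ℝ → ℝ}
    (hf : Continuous f) (hc : HasCompactSupport f) :
    Tendsto (fun η => ∫ h, 3 * η ^ 2 * regInv η h ^ 5 * f (hyperPoint c η h)) (𝓝[>] 0)
      (𝓝 (4 * Real.pi * f 0)) := by
  obtain ⟨M, hM⟩ := hc.exists_bound_of_continuous hf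
  have hscale : ∀ η : ℝ, 0 < η →
      ∫ h, 3 * η ^ 2 * regInv η h ^ 5 * f (hyperPoint c η h)
        = ∫ k, 3 * regInv 1 k ^ 5 * f (η • hyperPoint c 1 k) := by
    intro η hη
    have hsq : ∀ k : R3, √(‖η • k‖ ^ 2 + η ^ 2) = η * √(‖k‖ ^ 2 + 1 ^ 2) := fun k => by
      rw [norm_smul, Real.norm_of_nonneg hη.le,
        show (η * ‖k‖) ^ 2 + η ^ 2 = η ^ 2 * (‖k‖ ^ 2 + 1 ^ 2) by ring,
        Real.sqrt_mul (sq_nonneg η), Real.sqrt_sq hη.le]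
    have := Measure.integral_comp_smul (volume : Measure R3)
      (fun h => 3 * η ^ 2 * regInv η h ^ 5 * f (hyperPoint c η h)) η
    rw [finrank_euclideanSpace, Fintype.card_fin, abs_of_pos (by positivity), smul_eq_mul,
      inv_mul_eq_div, eq_div_iff (by positivity), ← integral_mul_const] at this
    rw [← this]
    congr 1 with k
    have e1 : hyperPoint c η (η • k) = η • hyperPoint c 1 k := by
      simp only [hyperPoint, hsq, Prod.smul_mk, smul_eq_mul, mul_div_assoc]
    rw [e1, regInv, hsq, regInv, mul_inv]
    field_simp
  rw [← integral_regInv_one_pow_five, ← integral_mul_const]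
  refine Tendsto.congr' (f₁ := fun η => ∫ k, 3 * regInv 1 k ^ 5 * f (η • hyperPoint c 1 k)) ?_ ?_
  · filter_upwards [self_mem_nhdsWithin] with η hη using (hscale η hη).symm
  · refine tendsto_integral_filter_of_dominated_convergence (fun k => 3 * regInv 1 k ^ 5 * M)
      (Eventually.of_forall fun η => ?_) (Eventually.of_forall fun η =>
        Eventually.of_forall fun k => ?_) (integrable_regInv_one_pow_five.mul_const M)
      (Eventually.of_forall fun k => ?_)
    · have h1 := continuous_regInv one_pos
      have h2 := continuous_hyperPoint c 1
      exact Continuous.aestronglyMeasurable (by fun_prop)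
    · have := regInv_nonneg 1 k
      rw [norm_mul, Real.norm_of_nonneg (by positivity)]
      gcongr
      exact hM _
    · have h1 : Continuous fun η : ℝ => f (η • hyperPoint c 1 k) := by fun_prop
      have h2 := (h1.tendsto 0).mono_left (nhdsWithin_le_nhds (s := Ioi 0))
      rw [zero_smul] at h2
      exact h2.const_mul _

/-- Of the three remainders on the hyperboloid, those with `η² s³` and `η² s⁴` are dominated by
`‖h‖⁻¹` and `‖h‖⁻²`, locally integrable in dimension three, and vanish in the limit. The one with
`η² s⁵` concentrates at the vertex and yields the point value. -/
theorem integral_norm_inv_waveOp {c : ℝ} {f : R3 × ℝ → ℝ}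
    (hf : ContDiff ℝ ∞ f) (hc : HasCompactSupport f) :
    ∫ h, ‖h‖⁻¹ * waveOp c f (conePoint c h) = 4 * Real.pi * f 0 := by
  have hW : waveOp c f = fun p => (1 / c ^ 2) * dirDeriv timeDir (dirDeriv timeDir f) p
      - ∑ i, dirDeriv (spaceDir i) (dirDeriv (spaceDir i) f) p :=
    funext (waveOp_eq_dirDeriv hf c)
  have h2c : ∀ v, Continuous (dirDeriv v (dirDeriv v f)) := fun v =>
    ((hf.dirDeriv v).dirDeriv v).continuous
  have h2s : ∀ v, HasCompactSupport (dirDeriv v (dirDeriv v f)) := fun v =>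
    (hc.dirDeriv v).dirDeriv v
  have hWc : Continuous (waveOp c f) := by
    rw [hW]
    exact (continuous_const.mul (h2c _)).sub (continuous_finsetSum _ fun i _ => h2c _)
  have hWs : HasCompactSupport (waveOp c f) := by
    rw [hW]
    simp only [Fin.sum_univ_three]
    exact (h2s timeDir).mul_left.sub (((h2s _).add (h2s _)).add (h2s _))
  have hL := tendsto_integral_kernel_comp_hyperPoint (c := c) hWc hWs (K := regInv)
    (fun η hη => continuous_regInv hη) integrableOn_norm_inv
    (fun η _ h hh => by
      rw [Real.norm_of_nonneg (regInv_nonneg η h)]; exact regInv_le η hh)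
    (fun h hh => tendsto_regInv hh)
  have hzero : Tendsto (fun η : ℝ => η ^ 2) (𝓝[>] 0) (𝓝 0) := by
    have h1 : Continuous fun η : ℝ => η ^ 2 := by fun_prop
    simpa using (h1.tendsto 0).mono_left (nhdsWithin_le_nhds (s := Ioi 0))
  have hE1 := tendsto_integral_kernel_comp_hyperPoint (c := c) (h2c timeDir) (h2s timeDir)
    (K := fun η h => η ^ 2 * regInv η h ^ 3) (K₀ := fun _ => 0)
    (fun η hη => continuous_const.mul ((continuous_regInv hη).pow 3)) integrableOn_norm_inv
    (fun η hη h hh => by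
      have h0 := regInv_nonneg η h
      rw [Real.norm_of_nonneg (by positivity)]
      calc η ^ 2 * regInv η h ^ 3 = (η ^ 2 * regInv η h ^ 2) * regInv η h := by ring
        _ ≤ 1 * ‖h‖⁻¹ := mul_le_mul (sq_mul_regInv_sq_le_one hη h) (regInv_le η hh) h0 zero_le_one
        _ = _ := one_mul _)
    (fun h hh => by simpa using hzero.mul ((tendsto_regInv hh).pow 3))
  have hE2 := tendsto_integral_kernel_comp_hyperPoint (c := c) (hf.dirDeriv timeDir).continuous
    (hc.dirDeriv timeDir)
    (K := fun η h => η ^ 2 * regInv η h ^ 4) (K₀ := fun _ => 0)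
    (fun η hη => continuous_const.mul ((continuous_regInv hη).pow 4)) integrableOn_norm_inv_sq
    (fun η hη h hh => by
      have h0 := regInv_nonneg η h
      rw [Real.norm_of_nonneg (by positivity), ← inv_pow]
      calc η ^ 2 * regInv η h ^ 4 = (η ^ 2 * regInv η h ^ 2) * regInv η h ^ 2 := by ring
        _ ≤ 1 * ‖h‖⁻¹ ^ 2 := mul_le_mul (sq_mul_regInv_sq_le_one hη h)
            (pow_le_pow_left₀ h0 (regInv_le η hh) 2) (by positivity) zero_le_one
        _ = _ := one_mul _)
    (fun h hh => by simpa using hzero.mul ((tendsto_regInv hh).pow 4))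
  have hE3 := tendsto_integral_regInv_pow_five (c := c) hf.continuous hc
  have hR := ((hE1.const_mul (c⁻¹ ^ 2)).sub (hE2.const_mul (3 * c⁻¹))).add hE3
  simp only [zero_mul, integral_zero, mul_zero, sub_zero, zero_add] at hR
  refine tendsto_nhds_unique hL (hR.congr' ?_)
  filter_upwards [self_mem_nhdsWithin] with η hη
  exact (integral_waveOp_hyperPoint hη hf hc).symm

/-- The advanced potential solves the inhomogeneous wave equation. -/
theorem waveOp_advancedPotential_eq {c : ℝ} {ψ : R3 × ℝ → ℝ} (hψ : ContDiff ℝ ∞ ψ)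
    (hc : HasCompactSupport ψ) (p : R3 × ℝ) :
    waveOp c (advancedPotential c ψ) p = ψ p := by
  -- Translation moves `p` to the origin, where `integral_norm_inv_waveOp` applies.
  have hψ' : ContDiff ℝ ∞ fun q => ψ (p + q) := hψ.comp (contDiff_const.add contDiff_id)
  have hc' : HasCompactSupport fun q => ψ (p + q) :=
    hc.comp_homeomorph (Homeomorph.addLeft p)
  have hshift : ∀ q, waveOp c (fun q => ψ (p + q)) q = waveOp c ψ (p + q) := fun q => by
    have h1 : ∀ v, dirDeriv v (fun q => ψ (p + q)) = fun q => dirDeriv v ψ (p + q) := fun v =>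
      funext fun q => dirDeriv_comp_add_left ψ v p q
    simp only [waveOp_eq_dirDeriv hψ', waveOp_eq_dirDeriv hψ, h1, dirDeriv_comp_add_left]
  have h := integral_norm_inv_waveOp (c := c) hψ' hc'
  simp only [hshift, add_zero] at h
  rw [waveOp_advancedPotential hψ hc]
  calc ∫ h, coneWeight h * waveOp c ψ (p + conePoint c h)
      = ∫ h, (4 * Real.pi)⁻¹ * (‖h‖⁻¹ * waveOp c ψ (p + conePoint c h)) := by
        congr 1 with h
        rw [coneWeight, one_div, mul_inv]
        ring
    _ = ψ p := by
        rw [integral_const_mul, h]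
        field_simp

/-! ### Arrival and emission times for a subsonic path. -/

/-- The time at which a signal of speed `c` that leaves `Z t` at time `t` arrives at `y`. -/
noncomputable def arrivalTime (c : ℝ) (Z : ℝ → R3) (y : R3) (t : ℝ) : ℝ := t + ‖y - Z t‖ / c

/-- The time at which a signal of speed `c` has to leave the path `Z` to arrive at `y` at
time `s`. -/
noncomputable def emissionTime (c : ℝ) (Z : ℝ → R3) (p : R3 × ℝ) : ℝ :=
  Function.invFun (arrivalTime c Z p.1) p.2

/-- `W` is the velocity, on `(0, T)`, of the path `Z` of speed at most `V`. -/
structure IsPathWithVelocity (V T : ℝ) (Z W : ℝ → R3) : Prop where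
  norm_sub_le : ∀ s t, ‖Z s - Z t‖ ≤ V * |s - t|
  continuous_velocity : Continuous W
  norm_velocity_le : ∀ t, ‖W t‖ ≤ V
  hasDerivAt : ∀ t ∈ Ioo 0 T, HasDerivAt Z (W t) t

namespace IsPathWithVelocity

variable {V T c : ℝ} {Z W : ℝ → R3}

theorem continuous_path (hZ : IsPathWithVelocity V T Z W) : Continuous Z := by
  refine (LipschitzWith.of_dist_le_mul (K := V.toNNReal) fun s t => ?_).continuous
  rw [dist_eq_norm, Real.dist_eq]
  exact (hZ.norm_sub_le s t).trans (by gcongr; exact Real.le_coe_toNNReal V)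

theorem speed_nonneg (hZ : IsPathWithVelocity V T Z W) : 0 ≤ V :=
  (norm_nonneg _).trans (hZ.norm_velocity_le 0)

/-- The propagation distance shrinks at rate at most `V`. For `V < c` this lower slope bound makes
the arrival time a bijection of the line, so that `emissionTime` is its true inverse. -/
theorem le_arrivalTime_sub (hZ : IsPathWithVelocity V T Z W) (hc : 0 < c) (y : R3) {s t : ℝ}
    (hst : s ≤ t) :
    (1 - V / c) * (t - s) ≤ arrivalTime c Z y t - arrivalTime c Z y s := by
  have h1 := norm_sub_norm_le (y - Z s) (y - Z t)
  have h2 := hZ.norm_sub_le t s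
  rw [abs_of_nonneg (by linarith)] at h2
  rw [sub_sub_sub_cancel_left] at h1
  have h3 : (‖y - Z s‖ - ‖y - Z t‖) / c ≤ V * (t - s) / c := by gcongr; linarith
  simp only [arrivalTime]
  rw [sub_div] at h3
  have : (1 - V / c) * (t - s) = (t - s) - V * (t - s) / c := by ring
  linarith

theorem continuous_arrivalTime (hZ : IsPathWithVelocity V T Z W) (c : ℝ) :
    Continuous fun p : R3 × ℝ => arrivalTime c Z p.1 p.2 := by
  have := hZ.continuous_path
  unfold arrivalTime
  fun_prop

theorem strictMono_arrivalTime (hZ : IsPathWithVelocity V T Z W) (hc : 0 < c) (hV : V < c)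
    (y : R3) : StrictMono (arrivalTime c Z y) := fun s t hst => by
  have h1 := hZ.le_arrivalTime_sub hc y hst.le
  have h2 : 0 < 1 - V / c := sub_pos.2 ((div_lt_one hc).2 hV)
  have := mul_pos h2 (sub_pos.2 hst)
  linarith

theorem surjective_arrivalTime (hZ : IsPathWithVelocity V T Z W) (hc : 0 < c) (hV : V < c)
    (y : R3) : Function.Surjective (arrivalTime c Z y) := by
  have h2 : 0 < 1 - V / c := sub_pos.2 ((div_lt_one hc).2 hV)
  have hcont : Continuous (arrivalTime c Z y) :=
    (hZ.continuous_arrivalTime c).comp (continuous_const.prodMk continuous_id)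
  refine hcont.surjective (tendsto_atTop_mono (fun t => ?_) tendsto_id) ?_
  · have : 0 ≤ ‖y - Z t‖ / c := by positivity
    simp only [arrivalTime, id]
    linarith
  · refine tendsto_atBot_mono' _ ?_ (tendsto_atBot_add_const_left _ (arrivalTime c Z y 0)
      (tendsto_id.const_mul_atBot h2))
    filter_upwards [eventually_le_atBot 0] with t ht
    have := hZ.le_arrivalTime_sub hc y ht
    simp only [id]
    linarith

theorem arrivalTime_emissionTime (hZ : IsPathWithVelocity V T Z W) (hc : 0 < c) (hV : V < c)
    (p : R3 × ℝ) : arrivalTime c Z p.1 (emissionTime c Z p) = p.2 :=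
  Function.rightInverse_invFun (hZ.surjective_arrivalTime hc hV p.1) p.2

theorem emissionTime_arrivalTime (hZ : IsPathWithVelocity V T Z W) (hc : 0 < c) (hV : V < c)
    (y : R3) (t : ℝ) : emissionTime c Z (y, arrivalTime c Z y t) = t :=
  Function.leftInverse_invFun (hZ.strictMono_arrivalTime hc hV y).injective t

/-- Dividing by the slope `1 - V / c` controls the emission time by the arrival time, and the
arrival time for a fixed emission is `1 / c`-Lipschitz in the receiver. -/
theorem continuous_emissionTime (hZ : IsPathWithVelocity V T Z W) (hc : 0 < c) (hV : V < c) :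
    Continuous (emissionTime c Z) := by
  have h2 : 0 < 1 - V / c := sub_pos.2 ((div_lt_one hc).2 hV)
  have key : ∀ p q : R3 × ℝ, (1 - V / c) * |emissionTime c Z p - emissionTime c Z q|
      ≤ (1 + 1 / c) * dist p q := by
    intro p q
    have h3 : (1 - V / c) * |emissionTime c Z p - emissionTime c Z q|
        ≤ |arrivalTime c Z p.1 (emissionTime c Z p)
          - arrivalTime c Z p.1 (emissionTime c Z q)| := by
      rcases le_total (emissionTime c Z p) (emissionTime c Z q) with h | h
      · rw [abs_sub_comm, abs_of_nonneg (sub_nonneg.2 h), abs_sub_comm]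
        exact (hZ.le_arrivalTime_sub hc p.1 h).trans (le_abs_self _)
      · rw [abs_of_nonneg (sub_nonneg.2 h)]
        exact (hZ.le_arrivalTime_sub hc p.1 h).trans (le_abs_self _)
    refine h3.trans ?_
    rw [hZ.arrivalTime_emissionTime hc hV]
    have h4 := hZ.arrivalTime_emissionTime hc hV q
    simp only [arrivalTime] at h4 ⊢
    set τ := emissionTime c Z q
    have h5 : p.2 - (τ + ‖p.1 - Z τ‖ / c)
        = (p.2 - q.2) + (‖q.1 - Z τ‖ - ‖p.1 - Z τ‖) / c := by
      rw [← h4]; ring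
    rw [h5]
    have h6 : |(‖q.1 - Z τ‖ - ‖p.1 - Z τ‖) / c| ≤ dist p q / c := by
      rw [abs_div, abs_of_pos hc]
      gcongr
      refine (abs_norm_sub_norm_le _ _).trans ?_
      rw [sub_sub_sub_cancel_right, ← dist_eq_norm, dist_comm]
      exact le_max_left _ _
    have h7 : |p.2 - q.2| ≤ dist p q := le_max_right _ _
    refine (abs_add_le _ _).trans ((add_le_add h7 h6).trans (le_of_eq ?_))
    ring
  refine (LipschitzWith.of_dist_le_mul (K := ((1 + 1 / c) / (1 - V / c)).toNNReal)
    fun p q => ?_).continuous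
  rw [Real.dist_eq, Real.coe_toNNReal _ (by positivity), div_mul_eq_mul_div, le_div_iff₀ h2,
    mul_comm]
  exact key p q

theorem emissionTime_le (hZ : IsPathWithVelocity V T Z W) (hc : 0 < c) (hV : V < c)
    (p : R3 × ℝ) : emissionTime c Z p ≤ p.2 := by
  have h := hZ.arrivalTime_emissionTime hc hV p
  have : 0 ≤ ‖p.1 - Z (emissionTime c Z p)‖ / c := by positivity
  rw [arrivalTime] at h
  linarith

theorem ne_path_emissionTime (hZ : IsPathWithVelocity V T Z W) (hc : 0 < c) (hV : V < c)
    {p : R3 × ℝ} (hp : p.1 ≠ Z p.2) : p.1 ≠ Z (emissionTime c Z p) := fun h => by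
  have h1 := hZ.arrivalTime_emissionTime hc hV p
  rw [arrivalTime, ← h, sub_self, norm_zero, zero_div, add_zero] at h1
  rw [h1] at h
  exact hp h

/-- Space-time parametrised by arrival point and time of emission. -/
noncomputable def arrivalHomeomorph (hZ : IsPathWithVelocity V T Z W) (hc : 0 < c) (hV : V < c) :
    R3 × ℝ ≃ₜ R3 × ℝ where
  toFun p := (p.1, arrivalTime c Z p.1 p.2)
  invFun p := (p.1, emissionTime c Z p)
  left_inv p := Prod.ext rfl (hZ.emissionTime_arrivalTime hc hV p.1 p.2)
  right_inv p := Prod.ext rfl (hZ.arrivalTime_emissionTime hc hV p)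
  continuous_toFun := continuous_fst.prodMk (hZ.continuous_arrivalTime c)
  continuous_invFun := continuous_fst.prodMk (hZ.continuous_emissionTime hc hV)

end IsPathWithVelocity

/-! ### The Liénard–Wiechert field and the change from emission to arrival time. -/

/-- The distance to the source at time `t`, with the Doppler correction. -/
noncomputable def dopplerDist (c : ℝ) (Z W : ℝ → R3) (y : R3) (t : ℝ) : ℝ :=
  ‖y - Z t‖ - inner ℝ (y - Z t) (W t) / c

/-- The Liénard–Wiechert field of a source on the path `Z` with signal `a`. -/
noncomputable def lienardWiechert (c : ℝ) (Z W : ℝ → R3) (a : ℝ → ℝ) (p : R3 × ℝ) : ℝ :=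
  a (emissionTime c Z p) / (4 * Real.pi * dopplerDist c Z W p.1 (emissionTime c Z p))

namespace IsPathWithVelocity

variable {V T c : ℝ} {Z W : ℝ → R3} {a : ℝ → ℝ}

theorem abs_dopplerDist_sub_le (hZ : IsPathWithVelocity V T Z W) (hc : 0 < c) (y : R3) (t : ℝ) :
    |dopplerDist c Z W y t - ‖y - Z t‖| ≤ V / c * ‖y - Z t‖ := by
  rw [dopplerDist, sub_sub_cancel_left, abs_neg, abs_div, abs_of_pos hc, div_mul_eq_mul_div]
  gcongr
  refine (abs_real_inner_le_norm _ _).trans ?_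
  rw [mul_comm]
  gcongr
  exact hZ.norm_velocity_le t

theorem le_dopplerDist (hZ : IsPathWithVelocity V T Z W) (hc : 0 < c) (y : R3) (t : ℝ) :
    (1 - V / c) * ‖y - Z t‖ ≤ dopplerDist c Z W y t := by
  have := (abs_le.1 (hZ.abs_dopplerDist_sub_le hc y t)).1
  linarith

theorem dopplerDist_pos (hZ : IsPathWithVelocity V T Z W) (hc : 0 < c) (hV : V < c) {y : R3}
    {t : ℝ} (hy : y ≠ Z t) : 0 < dopplerDist c Z W y t :=
  (mul_pos (sub_pos.2 ((div_lt_one hc).2 hV)) (norm_pos_iff.2 (sub_ne_zero.2 hy))).trans_le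
    (hZ.le_dopplerDist hc y t)

theorem isOpen_ne_path (hZ : IsPathWithVelocity V T Z W) : IsOpen {p : R3 × ℝ | p.1 ≠ Z p.2} :=
  isOpen_ne_fun continuous_fst (hZ.continuous_path.comp continuous_snd)

theorem continuousOn_lienardWiechert (hZ : IsPathWithVelocity V T Z W) (hc : 0 < c) (hV : V < c)
    (ha : Continuous a) :
    ContinuousOn (lienardWiechert c Z W a) {p | p.1 ≠ Z p.2} := by
  have h1 := hZ.continuous_emissionTime hc hV
  have h2 := hZ.continuous_path
  have h3 := hZ.continuous_velocity
  unfold lienardWiechert dopplerDist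
  refine ContinuousOn.div (by fun_prop) (by fun_prop) fun p hp => ?_
  exact (mul_pos (by positivity)
    (hZ.dopplerDist_pos hc hV (hZ.ne_path_emissionTime hc hV hp))).ne'

/-- This Jacobian is what replaces the distance in `1 / (4πr)` by the Doppler-corrected distance. -/
theorem hasDerivAt_arrivalTime (hZ : IsPathWithVelocity V T Z W) (hc : 0 < c) {y : R3} {t : ℝ}
    (ht : t ∈ Ioo 0 T) (hy : y ≠ Z t) :
    HasDerivAt (arrivalTime c Z y) (dopplerDist c Z W y t / ‖y - Z t‖) t := by
  have hn : 0 < ‖y - Z t‖ := norm_pos_iff.2 (sub_ne_zero.2 hy)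
  have h1 := (((hZ.hasDerivAt t ht).const_sub y).norm_sq).sqrt (by positivity)
  simp only [Real.sqrt_sq (norm_nonneg _)] at h1
  have h2 := (hasDerivAt_id t).add (h1.div_const c)
  convert! h2 using 1
  rw [dopplerDist, inner_neg_right]
  field_simp
  ring

end IsPathWithVelocity

theorem advancedPotential_eq_integral_sub (c : ℝ) (ψ : R3 × ℝ → ℝ) (x : R3) (t : ℝ) :
    advancedPotential c ψ (x, t) = ∫ y, coneWeight (y - x) * ψ (y, t + ‖y - x‖ / c) := by
  rw [advancedPotential, ← integral_sub_right_eq_self _ x]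
  congr 1 with y
  simp [conePoint]

namespace IsPathWithVelocity

variable {V T c : ℝ} {Z W : ℝ → R3} {a : ℝ → ℝ} {ψ : R3 × ℝ → ℝ}

theorem integral_arrivalTime_eq (hZ : IsPathWithVelocity V T Z W) (hc : 0 < c) (hV : V < c)
    (ha : ∀ t ≤ 0, a t = 0)
    (hψ : ∀ p, ψ p ≠ 0 → p.2 < T ∧ p.1 ≠ Z p.2) (y : R3) :
    ∫ t, a t * (coneWeight (y - Z t) * ψ (y, arrivalTime c Z y t))
      = ∫ s, lienardWiechert c Z W a (y, s) * ψ (y, s) := by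
  -- Only on `S` is the arrival time known to be differentiable. Nothing is lost outside: `a`
  -- vanishes for `t ≤ 0`, and a signal emitted at `t ≥ T` or from `y` itself arrives where `ψ` is
  -- zero.
  set S : Set ℝ := {t | t ∈ Ioo 0 T ∧ y ≠ Z t} with hS
  have hSm : MeasurableSet S := by
    refine measurableSet_Ioo.inter (IsOpen.measurableSet ?_)
    exact isOpen_ne_fun continuous_const hZ.continuous_path
  have hmono := hZ.strictMono_arrivalTime hc hV y
  have h1 : ∀ t, t ∉ S → a t * (coneWeight (y - Z t) * ψ (y, arrivalTime c Z y t)) = 0 := by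
    intro t ht
    by_contra hne
    have hat : 0 < t := by
      by_contra h
      exact hne (by rw [ha t (not_lt.1 h), zero_mul])
    have hψt : ψ (y, arrivalTime c Z y t) ≠ 0 := fun h => hne (by rw [h]; simp)
    have h2 := hψ _ hψt
    have h3 := hZ.emissionTime_le hc hV (y, arrivalTime c Z y t)
    have h4 := hZ.ne_path_emissionTime hc hV h2.2
    rw [hZ.emissionTime_arrivalTime hc hV] at h3 h4
    exact ht ⟨⟨hat, h3.trans_lt h2.1⟩, h4⟩
  have h2 : ∀ s, s ∉ arrivalTime c Z y '' S → lienardWiechert c Z W a (y, s) * ψ (y, s) = 0 := by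
    intro s hs
    by_contra hne
    have hψs : ψ (y, s) ≠ 0 := right_ne_zero_of_mul hne
    have hp := hψ _ hψs
    refine hs ⟨emissionTime c Z (y, s), ⟨⟨?_, ?_⟩, hZ.ne_path_emissionTime hc hV hp.2⟩,
      hZ.arrivalTime_emissionTime hc hV (y, s)⟩
    · by_contra h
      exact hne (by rw [lienardWiechert, ha _ (not_lt.1 h)]; simp)
    · exact (hZ.emissionTime_le hc hV (y, s)).trans_lt hp.1
  rw [← setIntegral_eq_integral_of_forall_compl_eq_zero h1,
    ← setIntegral_eq_integral_of_forall_compl_eq_zero h2,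
    integral_image_eq_integral_abs_deriv_smul hSm
      (fun t ht => (hZ.hasDerivAt_arrivalTime hc ht.1 ht.2).hasDerivWithinAt)
      hmono.injective.injOn]
  refine setIntegral_congr_fun hSm fun t ht => ?_
  have hn : 0 < ‖y - Z t‖ := norm_pos_iff.2 (sub_ne_zero.2 ht.2)
  have hD := hZ.dopplerDist_pos hc hV ht.2
  simp only [lienardWiechert, hZ.emissionTime_arrivalTime hc hV, smul_eq_mul, coneWeight]
  rw [abs_of_pos (by positivity)]
  field_simp

theorem integral_advancedPotential_eq (hZ : IsPathWithVelocity V T Z W) (hc : 0 < c) (hV : V < c)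
    (hac : Continuous a) (ha : ∀ t ≤ 0, a t = 0) (hψc : Continuous ψ) (hψs : HasCompactSupport ψ)
    (hψ : ∀ p ∈ tsupport ψ, p.2 < T ∧ p.1 ≠ Z p.2) :
    Integrable (fun p => lienardWiechert c Z W a p * ψ p) ∧
    ∫ t, a t * advancedPotential c ψ (Z t, t) = ∫ p, lienardWiechert c Z W a p * ψ p := by
  have hcont : ∀ k : R3 × ℝ → ℝ, ContinuousOn k {p | p.1 ≠ Z p.2} →
      Continuous fun p => k p * ψ p := by
    intro k hk
    refine (hk.mul hψc.continuousOn).continuous_of_tsupport_subset hZ.isOpen_ne_path ?_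
    exact (tsupport_mul_subset_right (f := k)).trans fun p hp => (hψ p hp).2
  have hLW : Integrable fun p => lienardWiechert c Z W a p * ψ p :=
    (hcont _ (hZ.continuousOn_lienardWiechert hc hV hac)).integrable_of_hasCompactSupport
      hψs.mul_left
  refine ⟨hLW, ?_⟩
  have hem := hZ.continuous_emissionTime hc hV
  have hpa := hZ.continuous_path
  have hG : Continuous fun p : R3 × ℝ => a (emissionTime c Z p)
      * coneWeight (p.1 - Z (emissionTime c Z p)) * ψ p := by
    refine hcont _ ?_
    unfold coneWeight
    refine ContinuousOn.mul (by fun_prop) (ContinuousOn.div (by fun_prop) (by fun_prop)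
      fun p hp => ?_)
    have := norm_pos_iff.2 (sub_ne_zero.2 (hZ.ne_path_emissionTime hc hV hp))
    positivity
  have hGs : HasCompactSupport fun p : R3 × ℝ => a (emissionTime c Z p)
      * coneWeight (p.1 - Z (emissionTime c Z p)) * ψ p := hψs.mul_left
  -- For Fubini: after `arrivalHomeomorph` the integrand is a continuous function of compact
  -- support, because `ψ` stays away from the singularity on the trajectory.
  have hH : Integrable fun p : R3 × ℝ =>
      a p.2 * (coneWeight (p.1 - Z p.2) * ψ (p.1, arrivalTime c Z p.1 p.2)) := by
    have h1 := (hG.comp (hZ.arrivalHomeomorph hc hV).continuous).integrable_of_hasCompactSupport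
      (μ := (volume : Measure (R3 × ℝ))) (hGs.comp_homeomorph (hZ.arrivalHomeomorph hc hV))
    refine h1.congr (Eventually.of_forall fun p => ?_)
    have e : hZ.arrivalHomeomorph hc hV p = (p.1, arrivalTime c Z p.1 p.2) := rfl
    simp only [Function.comp_apply, e, hZ.emissionTime_arrivalTime hc hV]
    ring
  rw [Measure.volume_eq_prod] at hH
  calc ∫ t, a t * advancedPotential c ψ (Z t, t)
      = ∫ t, ∫ y, a t * (coneWeight (y - Z t) * ψ (y, arrivalTime c Z y t)) := by
        simp only [advancedPotential_eq_integral_sub, ← integral_const_mul, arrivalTime]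
    _ = ∫ y, ∫ t, a t * (coneWeight (y - Z t) * ψ (y, arrivalTime c Z y t)) :=
        (integral_integral_swap hH).symm
    _ = ∫ y, ∫ s, lienardWiechert c Z W a (y, s) * ψ (y, s) := by
        congr 1 with y
        exact hZ.integral_arrivalTime_eq hc hV ha (fun p hp => hψ p (subset_tsupport _ hp)) y
    _ = ∫ p, lienardWiechert c Z W a p * ψ p := by
        rw [Measure.volume_eq_prod] at hLW ⊢
        exact (integral_prod _ hLW).symm

end IsPathWithVelocity

/-! ### Identification of the field by duality. -/

/-- The advanced potential is supported in the past of `ψ`, which is bounded above in time but not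
below. The cutoff equals `1` for `t ≥ 0` and `0` for `t ≤ -1`, so it bounds the support without
affecting positive times. -/
theorem exists_testFunction_waveOp_eq {c : ℝ} (hc : 0 < c) {ψ : R3 × ℝ → ℝ}
    (hψ : ContDiff ℝ ∞ ψ) (hψs : HasCompactSupport ψ) :
    ∃ φ : R3 × ℝ → ℝ, ContDiff ℝ ∞ φ ∧ HasCompactSupport φ ∧
      ∀ p : R3 × ℝ, 0 < p.2 → waveOp c φ p = ψ p ∧ φ p = advancedPotential c ψ p := by
  have hA := contDiff_advancedPotential (c := c) hψ hψs
  set φ : R3 × ℝ → ℝ := fun p => Real.smoothTransition (p.2 + 1) * advancedPotential c ψ p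
    with hφ
  have hφd : ContDiff ℝ ∞ φ :=
    (Real.smoothTransition.contDiff.comp (contDiff_snd.add contDiff_const)).mul hA
  have heq : ∀ p : R3 × ℝ, 0 < p.2 → φ p = advancedPotential c ψ p := fun p hp => by
    simp only [hφ]
    rw [Real.smoothTransition.one_of_one_le (by linarith), one_mul]
  refine ⟨φ, hφd, ?_, fun p hp => ⟨?_, heq p hp⟩⟩
  · obtain ⟨S, hS⟩ := hψs.isCompact.isBounded.subset_closedBall (0 : R3 × ℝ)
    refine HasCompactSupport.intro
      (isCompact_closedBall (0 : R3 × ℝ) (max (S + c * (S + 1)) (S + 1))) fun p hp => ?_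
    by_contra hne
    have h1 : -1 < p.2 := by
      by_contra h
      exact hne (by simp only [hφ]; rw [Real.smoothTransition.zero_of_nonpos (by linarith),
        zero_mul])
    have h2 : ∃ h, ψ (p + conePoint c h) ≠ 0 := by
      by_contra! h
      exact hne (by simp [hφ, advancedPotential, h])
    obtain ⟨h, hh⟩ := h2
    have h3 := hS (subset_tsupport _ hh)
    rw [mem_closedBall_zero_iff, norm_prod_le_iff] at h3
    obtain ⟨h4, h5⟩ := h3
    simp only [conePoint, Prod.fst_add, Prod.snd_add, Real.norm_eq_abs] at h4 h5
    have h6 := (abs_le.1 h5).2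
    have h7 : 0 ≤ ‖h‖ / c := by positivity
    have h8 : ‖h‖ ≤ c * (S + 1) := by
      rw [mul_comm, ← div_le_iff₀ hc]; linarith
    have h9 : ‖p.1‖ ≤ S + c * (S + 1) := by
      have := norm_sub_le (p.1 + h) h
      rw [add_sub_cancel_right] at this
      linarith
    refine hp ?_
    rw [mem_closedBall_zero_iff, norm_prod_le_iff]
    refine ⟨h9.trans (le_max_left _ _), le_trans ?_ (le_max_right _ _)⟩
    have h10 := (norm_nonneg _).trans h4
    rw [Real.norm_eq_abs, abs_le]
    constructor <;> linarith
  · rw [waveOp_congr_of_eventuallyEq hφd hA, waveOp_advancedPotential_eq hψ hψs]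
    filter_upwards [(isOpen_lt continuous_const continuous_snd).mem_nhds hp] with q hq
      using heq q hq

theorem integrable_mul_of_locallyIntegrableOn {u ψ : R3 × ℝ → ℝ} {s : Set (R3 × ℝ)}
    (hu : LocallyIntegrableOn u s) (hψ : Continuous ψ) (hψc : HasCompactSupport ψ)
    (hs : tsupport ψ ⊆ s) : Integrable fun p => u p * ψ p := by
  have h1 := hu.integrableOn_compact_subset hs hψc.isCompact
  have h2 := h1.mul_continuousOn hψ.continuousOn hψc.isCompact
  refine (integrableOn_iff_integrable_of_support_subset fun p hp => ?_).1 h2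
  exact subset_tsupport _ (right_ne_zero_of_mul hp)

/-- The field of a moving source is its Liénard–Wiechert field. -/
theorem IsMovingSourceField.eq_lienardWiechert {V T c ω₀ : ℝ} {Z W z : ℝ → R3} {u : R3 → ℝ → ℝ}
    (hu : IsMovingSourceField c ω₀ T z u) (hZ : IsPathWithVelocity V T Z W) (hc : 0 < c)
    (hV : V < c) (hT : 0 < T) (hz : ∀ t ∈ Icc 0 T, z t = Z t) {x : R3} {t : ℝ}
    (ht : t ∈ Ioo 0 T) (hx : x ≠ z t) :
    u x t = lienardWiechert c Z W (fun t => Real.sin (ω₀ * max t 0)) (x, t) := by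
  set a : ℝ → ℝ := fun t => Real.sin (ω₀ * max t 0) with ha
  have hac : Continuous a := by fun_prop
  have ha0 : ∀ t ≤ 0, a t = 0 := fun t ht => by simp [ha, max_eq_right ht]
  set U : Set (R3 × ℝ) := {p | p.2 ∈ Ioo 0 T} ∩ {p | p.1 ≠ Z p.2} with hUdef
  have hU : IsOpen U := (isOpen_Ioo.preimage continuous_snd).inter hZ.isOpen_ne_path
  have hzZ : ∀ t ∈ Ioo 0 T, z t = Z t := fun t ht => hz t (Ioo_subset_Icc_self ht)
  have hLWc : ContinuousOn (lienardWiechert c Z W a) U :=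
    (hZ.continuousOn_lienardWiechert hc hV hac).mono inter_subset_right
  have huc : ContinuousOn (fun p : R3 × ℝ => u p.1 p.2) U :=
    hu.continuousOn.mono fun p hp => ⟨hp.1.1, hp.1.2, by rw [hzZ _ hp.1]; exact hp.2⟩
  have hui : LocallyIntegrableOn (fun p : R3 × ℝ => u p.1 p.2) U :=
    hu.locallyIntegrable.mono_set fun p hp => hp.1.1.le
  have hLWi : LocallyIntegrableOn (lienardWiechert c Z W a) U :=
    hLWc.locallyIntegrableOn hU.measurableSet
  have hae : ∀ᵐ p : R3 × ℝ, p ∈ U → ((fun p : R3 × ℝ => u p.1 p.2)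
      - lienardWiechert c Z W a) p = 0 := by
    refine hU.ae_eq_zero_of_integral_contDiff_smul_eq_zero (hui.sub hLWi)
      fun ψ hψ hψs hψU => ?_
    have hi := integrable_mul_of_locallyIntegrableOn hui hψ.continuous hψs hψU
    obtain ⟨hi2, hLW⟩ := hZ.integral_advancedPotential_eq hc hV hac ha0 hψ.continuous hψs
      (fun p hp => ⟨(hψU hp).1.2, (hψU hp).2⟩)
    obtain ⟨φ, hφ, hφs, hφψ⟩ := exists_testFunction_waveOp_eq hc hψ hψs
    have hw := hu.weak_eq φ hφ hφs
    have e1 : ∫ p in {p : R3 × ℝ | 0 < p.2}, u p.1 p.2 * waveOp c φ p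
        = ∫ p : R3 × ℝ, u p.1 p.2 * ψ p := by
      rw [setIntegral_congr_fun (g := fun p : R3 × ℝ => u p.1 p.2 * ψ p)
        (measurableSet_lt measurable_const measurable_snd)
        (fun p hp => by simp only [(hφψ p hp).1])]
      refine setIntegral_eq_integral_of_forall_compl_eq_zero fun p hp => ?_
      have : ψ p = 0 := by
        by_contra h
        exact hp (hψU (subset_tsupport _ h)).1.1
      rw [this, mul_zero]
    have e2 : ∫ t in (0 : ℝ)..T, Real.sin (ω₀ * t) * φ (z t, t)
        = ∫ t, a t * advancedPotential c ψ (Z t, t) := by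
      rw [intervalIntegral.integral_of_le hT.le, integral_Ioc_eq_integral_Ioo,
        setIntegral_congr_fun (g := fun t => a t * advancedPotential c ψ (Z t, t))
        measurableSet_Ioo (fun t ht => by
          simp only [ha, hzZ t ht, (hφψ (Z t, t) ht.1).2, max_eq_left ht.1.le])]
      refine setIntegral_eq_integral_of_forall_compl_eq_zero fun t ht => ?_
      rcases le_or_gt t 0 with h | h
      · rw [ha0 t h, zero_mul]
      -- The future cone of a point at time `t ≥ T` misses the support of `ψ`.
      · have hTt : T ≤ t := by
          by_contra h'
          exact ht ⟨h, not_le.1 h'⟩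
        have : ∀ k, ψ ((Z t, t) + conePoint c k) = 0 := fun k => by
          by_contra hne
          have h1 := (hψU (subset_tsupport _ hne)).1.2
          have h2 : 0 ≤ ‖k‖ / c := by positivity
          simp only [conePoint, Prod.snd_add] at h1
          linarith
        simp [advancedPotential, this]
    rw [e1, e2, hLW] at hw
    calc ∫ p, ψ p • ((fun p : R3 × ℝ => u p.1 p.2) - lienardWiechert c Z W a) p
        = ∫ p : R3 × ℝ, (u p.1 p.2 * ψ p - lienardWiechert c Z W a p * ψ p) := by
          congr 1 with p
          simp only [Pi.sub_apply, smul_eq_mul]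
          ring
      _ = 0 := by rw [integral_sub hi hi2, hw, sub_self]
  have hae' : (fun p : R3 × ℝ => u p.1 p.2) =ᵐ[volume.restrict U] lienardWiechert c Z W a := by
    refine (ae_restrict_iff' hU.measurableSet).2 ?_
    filter_upwards [hae] with p hp hpU using sub_eq_zero.1 (hp hpU)
  exact Measure.eqOn_open_of_ae_eq hae' hU huc hLWc
    (show (x, t) ∈ U from ⟨ht, fun h => hx (h.trans (hzZ t ht).symm)⟩)

/-! ### Extension of the path and the quantitative comparison. -/

/-- A `C¹` path on `[0, T]` of speed at most `V`, extended by rest, is a path with velocity. -/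
theorem isPathWithVelocity_projIcc {V T : ℝ} (hT : 0 < T) {z : ℝ → R3}
    (hz : ContDiffOn ℝ 1 z (Icc 0 T)) (hV : ∀ t ∈ Ioo 0 T, ‖deriv z t‖ ≤ V) :
    IsPathWithVelocity V T (fun t => z (projIcc 0 T hT.le t))
      (fun t => derivWithin z (Icc 0 T) (projIcc 0 T hT.le t)) := by
  have hud := uniqueDiffOn_Icc hT
  have hdc : ContinuousOn (derivWithin z (Icc 0 T)) (Icc 0 T) :=
    hz.continuousOn_derivWithin hud le_rfl
  have hbound : ∀ t ∈ Icc 0 T, ‖derivWithin z (Icc 0 T) t‖ ≤ V := by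
    have h1 : MapsTo (derivWithin z (Icc 0 T)) (Ioo 0 T) (Metric.closedBall 0 V) := fun t ht => by
      rw [derivWithin_of_mem_nhds (Icc_mem_nhds ht.1 ht.2), mem_closedBall_zero_iff]
      exact hV t ht
    -- The speed bound is given on the open interval only; continuity of the one-sided derivative
    -- carries it to the endpoints.
    have h2 := h1.closure_of_continuousOn (by rwa [closure_Ioo hT.ne])
    rw [closure_Ioo hT.ne, Metric.isClosed_closedBall.closure_eq] at h2
    exact fun t ht => mem_closedBall_zero_iff.1 (h2 ht)
  have hV0 : 0 ≤ V := (norm_nonneg _).trans (hbound 0 (left_mem_Icc.2 hT.le))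
  refine ⟨fun s t => ?_, ?_, fun t => hbound _ (projIcc 0 T hT.le t).2, fun t ht => ?_⟩
  · have h1 := (convex_Icc 0 T).norm_image_sub_le_of_norm_derivWithin_le
      (hz.differentiableOn one_ne_zero) hbound (projIcc 0 T hT.le t).2 (projIcc 0 T hT.le s).2
    refine h1.trans ?_
    gcongr
    exact abs_projIcc_sub_projIcc hT.le
  · exact hdc.comp_continuous (continuous_subtype_val.comp continuous_projIcc)
      fun t => (projIcc 0 T hT.le t).2
  · have hmem : Icc 0 T ∈ 𝓝 t := Icc_mem_nhds ht.1 ht.2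
    have h1 : HasDerivAt z (derivWithin z (Icc 0 T) t) t :=
      ((hz.differentiableOn one_ne_zero) t
        (Ioo_subset_Icc_self ht)).hasDerivWithinAt.hasDerivAt hmem
    simp only [projIcc_of_mem hT.le (Ioo_subset_Icc_self ht)]
    refine h1.congr_of_eventuallyEq ?_
    filter_upwards [hmem] with s hs
    rw [projIcc_of_mem hT.le hs]

/-- The splitting pairs the difference of denominators with `β`, which becomes `sin (ω₀ t)`; its
smallness at low frequency is needed there. -/
theorem abs_div_sub_div_le {α β D r m ρ : ℝ} (hm : 0 < m) (hD : m ≤ D) (hρ : 0 < ρ)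
    (hr : ρ ≤ r) :
    |α / (4 * Real.pi * D) - β / (4 * Real.pi * r)|
      ≤ |α - β| / (4 * Real.pi * m) + |β| * |D - r| / (4 * Real.pi * (m * ρ)) := by
  have hD0 := hm.trans_le hD
  have hr0 := hρ.trans_le hr
  have hpi := Real.pi_pos
  have e : α / (4 * Real.pi * D) - β / (4 * Real.pi * r)
      = (α - β) / (4 * Real.pi * D) + -(β * (D - r)) / (4 * Real.pi * (D * r)) := by
    field_simp
    ring
  rw [e]
  refine (abs_add_le _ _).trans (add_le_add ?_ ?_)
  · rw [abs_div, abs_of_pos (a := 4 * Real.pi * D) (by positivity)]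
    gcongr
  · rw [abs_div, abs_of_pos (a := 4 * Real.pi * (D * r)) (by positivity), abs_neg, abs_mul]
    gcongr

/-- A source signal differs little from the received one, relative to the number of periods
`e` that passes during propagation. -/
theorem abs_lienardWiechert_sub_le {V T c q δ Λ ω₀ e : ℝ} {Z W : ℝ → R3}
    (hZ : IsPathWithVelocity V T Z W) (hc : 0 < c) (hq : q < 1) (hVq : V ≤ q * c) (hω₀ : 0 < ω₀)
    (hδ : 0 < δ) (hΛ : min T (1 / ω₀) ≤ Λ) {x : R3} {t : ℝ} (ht : t ∈ Ioo 0 T)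
    (hd : ∀ s, δ ≤ ‖x - Z s‖)
    (he : t - emissionTime c Z (x, t) ≤ e * (2 * Real.pi / ω₀)) :
    |lienardWiechert c Z W (fun t => Real.sin (ω₀ * max t 0)) (x, t)
      - Real.sin (ω₀ * t) / (4 * Real.pi * ‖x - Z t‖)|
      ≤ (1 / (2 * ((1 - q) * δ)) + V * Λ / ((1 - q) * δ * δ)) * e := by
  have hV : V < c := by nlinarith
  have hV0 := hZ.speed_nonneg
  have hpi := Real.pi_pos
  have hq1 : 0 < 1 - q := sub_pos.2 hq
  have hcq : V / c ≤ q := (div_le_iff₀ hc).2 hVq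
  set τ := emissionTime c Z (x, t) with hτ
  have hτt : τ ≤ t := hZ.emissionTime_le hc hV (x, t)
  have harr : τ + ‖x - Z τ‖ / c = t := hZ.arrivalTime_emissionTime hc hV (x, t)
  have hrτ : ‖x - Z τ‖ = c * (t - τ) := by
    field_simp at harr
    linarith
  have hD : (1 - q) * δ ≤ dopplerDist c Z W x τ := by
    refine le_trans ?_ (hZ.le_dopplerDist hc x τ)
    have := hd τ
    have h0 : 0 ≤ 1 - V / c := by linarith
    gcongr
  have h1 : |Real.sin (ω₀ * max τ 0) - Real.sin (ω₀ * t)| ≤ 2 * Real.pi * e := by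
    have hlip : |Real.sin (ω₀ * max τ 0) - Real.sin (ω₀ * t)| ≤ |ω₀ * max τ 0 - ω₀ * t| := by
      simpa [Real.dist_eq] using Real.lipschitzWith_sin.dist_le_mul (ω₀ * max τ 0) (ω₀ * t)
    refine hlip.trans ?_
    rw [← mul_sub, abs_mul, abs_of_pos hω₀, abs_sub_comm,
      abs_of_nonneg (sub_nonneg.2 (max_le hτt ht.1.le))]
    calc ω₀ * (t - max τ 0) ≤ ω₀ * (e * (2 * Real.pi / ω₀)) := by
          gcongr
          have := le_max_left τ 0
          linarith
      _ = 2 * Real.pi * e := by field_simp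
  -- One `V (t - τ)` is the Doppler correction, as `‖x - Z τ‖ = c (t - τ)`; the other is the motion
  -- of the source during propagation.
  have h2 : |dopplerDist c Z W x τ - ‖x - Z t‖| ≤ 2 * V * (t - τ) := by
    have h3 := hZ.abs_dopplerDist_sub_le hc x τ
    have h4 : |‖x - Z τ‖ - ‖x - Z t‖| ≤ V * (t - τ) := by
      refine (abs_norm_sub_norm_le _ _).trans ?_
      rw [sub_sub_sub_cancel_left]
      refine (hZ.norm_sub_le t τ).trans_eq ?_
      rw [abs_of_nonneg (sub_nonneg.2 hτt)]
    have h5 : V / c * ‖x - Z τ‖ = V * (t - τ) := by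
      rw [hrτ]; field_simp
    have := abs_sub_le (dopplerDist c Z W x τ) ‖x - Z τ‖ ‖x - Z t‖
    linarith
  -- The bound by `T` comes from `|sin θ| ≤ |θ|`, the bound by `1 / ω₀` from `|sin θ| ≤ 1`.
  have hsin : |Real.sin (ω₀ * t)| * (1 / ω₀) ≤ Λ := by
    refine le_trans (le_min ?_ ?_) hΛ
    · rw [mul_one_div, div_le_iff₀ hω₀]
      have := Real.abs_sin_le_abs (x := ω₀ * t)
      rw [abs_of_pos (mul_pos hω₀ ht.1)] at this
      nlinarith [ht.2]
    · have := Real.abs_sin_le_one (ω₀ * t)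
      have h0 : 0 ≤ 1 / ω₀ := by positivity
      nlinarith
  have he0 : 0 ≤ e := by
    by_contra h
    have : e * (2 * Real.pi / ω₀) < 0 := mul_neg_of_neg_of_pos (not_le.1 h) (by positivity)
    linarith
  have h6 : |Real.sin (ω₀ * t)| * |dopplerDist c Z W x τ - ‖x - Z t‖|
      ≤ 4 * Real.pi * (V * Λ * e) := by
    calc |Real.sin (ω₀ * t)| * |dopplerDist c Z W x τ - ‖x - Z t‖|
        ≤ |Real.sin (ω₀ * t)| * (2 * V * (e * (2 * Real.pi / ω₀))) := by
          gcongr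
          exact h2.trans (by gcongr)
      _ = 4 * Real.pi * (V * (|Real.sin (ω₀ * t)| * (1 / ω₀)) * e) := by ring
      _ ≤ 4 * Real.pi * (V * Λ * e) := by gcongr
  refine (abs_div_sub_div_le (mul_pos hq1 hδ) hD hδ (hd t)).trans ?_
  rw [add_mul]
  refine add_le_add ?_ ?_
  · calc _ ≤ 2 * Real.pi * e / (4 * Real.pi * ((1 - q) * δ)) := by
          have := mul_pos hq1 hδ
          gcongr
      _ = _ := by field_simp; ring
  · calc _ ≤ 4 * Real.pi * (V * Λ * e) / (4 * Real.pi * ((1 - q) * δ * δ)) := by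
          have := mul_pos hq1 hδ
          gcongr
      _ = _ := by field_simp

theorem theorem2p2 (δ q V Λ : ℝ) (hδ : 0 < δ) (hq : q < 1) :
    ∃ C : ℝ, 0 < C ∧
      ∀ c₀ ω₀ T : ℝ, 0 < c₀ → 0 < ω₀ → 0 < T → V ≤ q * c₀ → min T (1 / ω₀) ≤ Λ →
      ∀ z : ℝ → R3, ContDiffOn ℝ 1 z (Icc 0 T) → (∀ t ∈ Ioo 0 T, ‖deriv z t‖ ≤ V) →
      ∀ Γ : Set R3, (∀ x ∈ Γ, ∀ t ∈ Icc 0 T, δ ≤ ‖x - z t‖) →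
      ∀ u₀ : R3 → ℝ → ℝ, IsMovingSourceField c₀ ω₀ T z u₀ →
      ∀ τ : R3 → ℝ → ℝ, (∀ x ∈ Γ, ∀ t ∈ Ioo 0 T, IsRetardedTime c₀ z x t (τ x t)) →
      ∀ ε : ℝ → ℝ, (∀ x ∈ Γ, ∀ t ∈ Ioo 0 T, t - τ x t ≤ ε t * (2 * Real.pi / ω₀)) →
      ∀ x ∈ Γ, ∀ t ∈ Ioo 0 T,
        |u₀ x t - Real.sin (ω₀ * t) / (4 * Real.pi * ‖x - z t‖)| ≤ C * ε t := by
  have hq1 : 0 < 1 - q := sub_pos.2 hq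
  -- The absolute values make the constant positive before any path is given; an admissible path and
  -- source then force `V` and `Λ` to be nonnegative.
  refine ⟨1 / (2 * ((1 - q) * δ)) + |V| * |Λ| / ((1 - q) * δ * δ), by positivity, ?_⟩
  intro c ω₀ T hc hω₀ hT hVq hΛ z hz hzV Γ hΓ u hu τ hτ ε hε x hx t ht
  have hZ := isPathWithVelocity_projIcc hT hz hzV
  set Z : ℝ → R3 := fun t => z (projIcc 0 T hT.le t) with hZdef
  have hzZ : ∀ t ∈ Icc 0 T, z t = Z t := fun t ht => by
    simp only [hZdef, projIcc_of_mem hT.le ht]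
  have hV : V < c := by nlinarith
  have hV0 := hZ.speed_nonneg
  have hΛ0 : 0 ≤ Λ := (le_min hT.le (by positivity)).trans hΛ
  have htI := Ioo_subset_Icc_self ht
  have hxz : x ≠ z t := fun h => by
    have := hΓ x hx t htI
    rw [h, sub_self, norm_zero] at this
    linarith
  have hret : emissionTime c Z (x, t) = τ x t := by
    have h1 : τ x t = t - ‖x - z (max (τ x t) 0)‖ / c := hτ x hx t ht
    have h2 : 0 ≤ ‖x - z (max (τ x t) 0)‖ / c := by positivity
    -- Both extensions rest at `z 0` before time `0`, and the clamp of `Z` at `T` is inactive since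
    -- `τ x t ≤ t < T`.
    have h3 : z (max (τ x t) 0) = Z (τ x t) := by
      simp only [hZdef, coe_projIcc]
      rw [min_eq_right (by linarith [ht.2]), max_comm]
    rw [h3] at h1
    have h4 : t = arrivalTime c Z x (τ x t) := by
      rw [arrivalTime]; linarith
    conv_lhs => rw [h4]
    exact hZ.emissionTime_arrivalTime hc hV x (τ x t)
  rw [hu.eq_lienardWiechert hZ hc hV hT hzZ ht hxz, hzZ t htI, abs_of_nonneg hV0,
    abs_of_nonneg hΛ0]
  exact abs_lienardWiechert_sub_le hZ hc hq hVq hω₀ hδ hΛ ht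
    (fun s => hΓ x hx _ (projIcc 0 T hT.le s).2) (by rw [hret]; exact hε x hx t ht)
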